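/- **Setting.** Let $n\ge 2$. All diagrams below have $n+1$ northern and $n+1$ southern vertices, each row numbered $1,\dots,n+1$ from left to right. *Coset diagrams.* A coset diagram of type $(C_n,A_{n-1})$ is a word $\lambda$ of length $n+1$ whose first letter is $\circ$ and whose other letters are arbitrary arrows $\wedge$ or $\vee$. A coset diagram of type $(D_{n+1},A_n)$ is a word of length $n+1$ in $\wedge,\vee$ with an even number of letters $\wedge$. For $\lambda$ of type $(C_n,A_{n-1})$, the *parity specialisation* $\overline\lambda$ of type $(D_{n+1},A_n)$ is obtained by replacing $\circ$ by the arrow that makes the total number of $\wedge$ even. *Decorated tangles.* A (loop-free) decorated tangle $d$ is a perfect matching of the $2n+2$ vertices by non-crossing strands inside a rectangular frame, up to isotopy, together with a choice of some *left exposed* strands (those which can be deformed to touch the left side of the frame), each of which is decorated with one bead. An *arc* is a strand joining two vertices of the same row. Write $1$ and $1'$ for the first northern and the first southern vertex. The tangle is of type $C_n$ if (1) $1$ and $1'$ are joined by an undecorated strand, or (2) $1$ and $1'$ are joined by a decorated strand and there are at least one northern and at least one southern arc, or (3) $1$ and $1'$ lie on two distinct strands, both decorated. It is of type $D_{n+1}$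 if the number of beads is even. *Oriented tangles.* Let $(W,P)$ be $(C_n,A_{n-1})$ or $(D_{n+1},A_n)$. An oriented tangle $\lambda d\mu$ of type $(W,P)$ consists of a decorated tangle $d$ of type $W$, with northern vertices labelled by a coset diagram $\lambda$ and southern vertices labelled by a coset diagram $\mu$ of type $(W,P)$. A strand is *oriented* if one of the arrows at its two ends points into the frame and the other one out of it, and *flip-oriented* if both point into the frame or both point out of it; a strand with an end labelled $\circ$ counts as both. It is required that every undecorated strand is oriented; that in type $(D_{n+1},A_n)$ every decorated strand is flip-oriented; and that in type $(C_n,A_{n-1})$ a strand with both ends labelled $\circ$ is undecorated. *The algebra.* $\mathrm{TL}^{\wedge\vee}_{(W,P)}(q)$ is the associative unital $\mathbb Z[q,q^{-1}]$-algebra with basis the oriented tangles of type $(W,P)$ and the following product. If $\mu\ne\lambda'$ then $(\lambda d\mu)(\lambda' d'\mu')=0$. If $\mu=\lambda'$, place $d$ above $d'$ and identify the southern vertices of $d$ with the northern vertices of $d'$. Every closed loop (decorated or not) is removed and replaced by the factor $q$ if its rightmost vertex is labelled $\vee$ and by $q^{-1}$ if it is labelled $\wedge$. On each remaining strand, two beads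 are replaced by one bead in type $C$, and by none in type $D$; and in type $C$ a bead on a strand with both ends labelled $\circ$ is removed. The result, labelled by $\lambda$ and $\mu'$, is an oriented tangle. The unit is $\sum_\lambda \lambda 1\lambda$, where $1$ is the undecorated tangle of vertical strands. *The grading.* The algebra is $\mathbb Z$-graded with $\deg q=1$, $\deg q^{-1}=-1$ and $$\deg(\lambda d\mu)=\#\{\text{northern arcs whose right end is labelled }\vee\}-\#\{\text{southern arcs whose right end is labelled }\wedge\},$$ the homogeneous part of degree $i$ being spanned over $\mathbb Z$ by the elements $q^k\,\lambda d\mu$ with $k+\deg(\lambda d\mu)=i$. **Proposition.** For every $n\ge 2$ there is a surjective homomorphism of $\mathbb Z[q,q^{-1}]$-algebras $$\varphi:\mathrm{TL}^{\wedge\vee}_{(C_n,A_{n-1})}(q)\longrightarrow \mathrm{TL}^{\wedge\vee}_{(D_{n+1},A_n)}(q)$$ which is graded (it maps homogeneous elements of degree $i$ to homogeneous elements of degree $i$, for all $i\in\mathbb Z$), and which sends each oriented tangle $\lambda d\mu$ of type $(C_n,A_{n-1})$ to the oriented tangle of type $(D_{n+1},A_n)$ obtained from $\overline\lambda d\overline\mu$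 by removing the beads from all decorated strands that are oriented with respect to $\overline\lambda,\overline\mu$. (In particular, the latter is an oriented tangle of type $(D_{n+1},A_n)$.) -/

import Mathlib

set_option linter.unusedSectionVars false

namespace OrientedTL

/-- The labels of a vertex: an up arrow `∧`, a down arrow `∨`, or the symbol `∘`. -/
inductive Mark where
  | wedge
  | vee
  | circ
  deriving DecidableEq

instance : Fintype Mark := ⟨{.wedge, .vee, .circ}, by rintro (_ | _ | _) <;> simp⟩

/-- The two families of Hermitian symmetric pairs under consideration. For a parameter `n`,
`C` stands for the pair `(C_n, A_{n-1})` and `D` stands for the pair `(D_{n+1}, A_n)`. In both cases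
the diagrams have `n + 1` vertices on each side. -/
inductive PairType where
  | C
  | D
  deriving DecidableEq

/-- A finite set of boundary points `α` of a frame (or of several frames drawn next to each other):
`pos` orders the points in the order in which they are met when the boundary is traversed clockwise,
starting and ending at the left-hand side of the frame; `south` tells whether a point lies on a
southern edge; `mark` is the label of the point. -/
structure Frame (α : Type) where
  pos : α → ℕ
  south : α → Bool
  mark : α → Mark

namespace Frame
variable {α : Type}

/-- The point carries an arrow that points into the frame: `∨` on a northern edge, `∧` on a southern one. -/
def Inward (F : Frame α) (x : α) : Prop :=
  (F.south x = false ∧ F.mark x = .vee) ∨ (F.south x = true ∧ F.mark x = .wedge)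

/-- A strand with ends `x`, `y` is oriented if exactly one of the two arrows at its ends points into
the frame. A strand with an end labelled `∘` counts as oriented (and also as flip-oriented). -/
def Oriented (F : Frame α) (x y : α) : Prop :=
  F.mark x = .circ ∨ F.mark y = .circ ∨ (F.Inward x ↔ ¬ F.Inward y)

/-- A strand is flip-oriented if the arrows at its ends both point into the frame, or both out of it. -/
def FlipOriented (F : Frame α) (x y : α) : Prop :=
  F.mark x = .circ ∨ F.mark y = .circ ∨ (F.Inward x ↔ F.Inward y)

theorem Oriented.symm {F : Frame α} {x y : α} (h : F.Oriented x y) : F.Oriented y x := by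
  unfold Oriented at *; grind

theorem FlipOriented.symm {F : Frame α} {x y : α} (h : F.FlipOriented x y) :
    F.FlipOriented y x := by
  unfold FlipOriented at *; grind

end Frame

/-- A system of strands on the boundary points `α`: the strand at `x` ends at `pair x`, and `bead x`
tells whether it carries a bead. In the course of a concatenation a point that has been removed
is recorded as a fixed point of `pair`. -/
@[ext]
structure Config (α : Type) where
  pair : α → α
  bead : α → Bool

namespace Config
variable {α : Type}

/-- No two strands cross. -/
def NonCrossing (S : Config α) (pos : α → ℕ) : Prop :=
  ∀ x y, pos x < pos y → pos y < pos (S.pair x) →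
    pos x < pos (S.pair y) ∧ pos (S.pair y) < pos (S.pair x)

/-- The strand at `x` is left exposed: it can be deformed so as to touch the left-hand side, that is, no
other strand separates it from the place where the traversal of the boundary starts. -/
def Exposed (S : Config α) (pos : α → ℕ) (x : α) : Prop :=
  ∀ y, ¬ (pos y < pos x ∧ pos y < pos (S.pair x) ∧
    pos x < pos (S.pair y) ∧ pos (S.pair x) < pos (S.pair y))

/-- The bead of the strand from `a` to `b` obtained by connecting two strands with beads `c` and `d`:
in type `C` two beads merge into one, in type `D` they cancel; a bead on a strand both of whose ends
are labelled `∘` is removed. -/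
def fuse (ty : PairType) (F : Frame α) (a b : α) (c d : Bool) : Bool :=
  if F.mark a = .circ ∧ F.mark b = .circ then false
  else match ty with
    | .C => c || d
    | .D => xor c d

variable [DecidableEq α]

/-- Connect the strands that end in the points `i` and `j` by gluing `i` to `j`, and remove these two
points. If `i` and `j` are the ends of one strand, this closes a loop, which is removed. -/
def join (ty : PairType) (F : Frame α) (S : Config α) (i j : α) : Config α where
  pair x :=
    if x = i ∨ x = j then x
    else if S.pair x = i then S.pair j
    else if S.pair x = j then S.pair i
    else S.pair x
  bead x :=
    if x = i ∨ x = j then false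
    else if S.pair x = i ∨ S.pair x = j then
      fuse ty F (S.pair i) (S.pair j) (S.bead i) (S.bead j)
    else S.bead x

/-- The exponent of `q` contributed by gluing `i` to `j`: if a closed loop is formed, it is `1` if the
point that is glued is labelled `∨` and `-1` if it is labelled `∧`. The points of a seam are glued from
left to right, so a loop is closed exactly when its rightmost vertex is glued. -/
def loopDegree (F : Frame α) (S : Config α) (i j : α) : ℤ :=
  if S.pair i = j then (if F.mark i = .vee then 1 else -1) else 0

/-- Invariant of the gluing process (used in proofs only): an oriented, decorated system of strands on
the points outside `dead`. -/
structure Valid (ty : PairType) (F : Frame α) (dead : Set α) (S : Config α) : Prop where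
  inv : ∀ x, S.pair (S.pair x) = x
  dead_iff : ∀ x, S.pair x = x ↔ x ∈ dead
  nc : S.NonCrossing F.pos
  bead_pair : ∀ x, S.bead (S.pair x) = S.bead x
  bead_dead : ∀ x ∈ dead, S.bead x = false
  exposed : ∀ x, S.bead x = true → S.Exposed F.pos x
  oriented : ∀ x, x ∉ dead → S.bead x = false → F.Oriented x (S.pair x)
  flip : ty = .D → ∀ x, S.bead x = true → F.FlipOriented x (S.pair x)
  noCirc : ty = .D → ∀ x, F.mark x ≠ .circ
  circ : ty = .C → ∀ x, x ∉ dead → F.mark x = .circ →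
    (S.bead x = true ↔ F.mark (S.pair x) ≠ .circ)

/-- When two points can be glued (used in proofs only). -/
structure Joinable (F : Frame α) (dead : Set α) (i j : α) : Prop where
  lt : F.pos i < F.pos j
  left : i ∉ dead
  right : j ∉ dead
  between : ∀ x, F.pos i < F.pos x → F.pos x < F.pos j → x ∈ dead
  south_left : F.south i = true
  south_right : F.south j = false
  mark : F.mark i = F.mark j

variable {ty : PairType} {F : Frame α} {dead : Set α} {S : Config α} {i j : α}

theorem join_pair_self {x : α} (h : x = i ∨ x = j) : (S.join ty F i j).pair x = x := by
  simp [join, h]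

theorem join_bead_self {x : α} (h : x = i ∨ x = j) : (S.join ty F i j).bead x = false := by
  simp only [join, if_pos h]

theorem join_pair_left {x : α} (h1 : x ≠ i) (h2 : x ≠ j) (h : S.pair x = i) :
    (S.join ty F i j).pair x = S.pair j := by
  simp [join, h1, h2, h]

theorem join_pair_right {x : α} (h1 : x ≠ i) (h2 : x ≠ j) (hij : i ≠ j) (h : S.pair x = j) :
    (S.join ty F i j).pair x = S.pair i := by
  simp [join, h1, h2, h, hij.symm]

theorem join_bead_new {x : α} (h1 : x ≠ i) (h2 : x ≠ j) (h : S.pair x = i ∨ S.pair x = j) :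
    (S.join ty F i j).bead x =
      fuse ty F (S.pair i) (S.pair j) (S.bead i) (S.bead j) := by
  simp [join, h1, h2, h]

theorem join_bead_other {x : α} (h1 : x ≠ i) (h2 : x ≠ j) (h3 : S.pair x ≠ i)
    (h4 : S.pair x ≠ j) : (S.join ty F i j).bead x = S.bead x := by
  simp [join, h1, h2, h3, h4]

theorem Valid.sep (h : S.Valid ty F dead) (y z : α)
    (hz : (F.pos y < F.pos z ∧ F.pos z < F.pos (S.pair y)) ∨
      (F.pos (S.pair y) < F.pos z ∧ F.pos z < F.pos y)) :
    (F.pos y < F.pos (S.pair z) ∧ F.pos (S.pair z) < F.pos (S.pair y)) ∨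
      (F.pos (S.pair y) < F.pos (S.pair z) ∧ F.pos (S.pair z) < F.pos y) := by
  rcases hz with ⟨h1, h2⟩ | ⟨h1, h2⟩
  · exact .inl (h.nc y z h1 h2)
  · have := h.nc (S.pair y) z h1
    rw [h.inv] at this
    exact .inr (this h2)

/-- The four kinds of points after a strand has been joined. -/
theorem Valid.cases (h : S.Valid ty F dead) (hij : Joinable F dead i j) (x : α) :
    (x = i ∨ x = j) ∨
    (x ≠ i ∧ x ≠ j ∧ x = S.pair i ∧ S.pair x = i ∧ (S.join ty F i j).pair x = S.pair j ∧
      (S.join ty F i j).bead x = fuse ty F (S.pair i) (S.pair j) (S.bead i) (S.bead j)) ∨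
    (x ≠ i ∧ x ≠ j ∧ x = S.pair j ∧ S.pair x = j ∧ (S.join ty F i j).pair x = S.pair i ∧
      (S.join ty F i j).bead x = fuse ty F (S.pair i) (S.pair j) (S.bead i) (S.bead j)) ∨
    (x ≠ i ∧ x ≠ j ∧ x ≠ S.pair i ∧ x ≠ S.pair j ∧ S.pair x ≠ i ∧ S.pair x ≠ j ∧
      (S.join ty F i j).pair x = S.pair x ∧ (S.join ty F i j).bead x = S.bead x) := by
  have hne : i ≠ j := fun e => by have := hij.lt; rw [e] at this; omega
  by_cases h0 : x = i ∨ x = j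
  · exact .inl h0
  obtain ⟨h1, h2⟩ := not_or.1 h0
  by_cases h3 : S.pair x = i
  · exact .inr (.inl ⟨h1, h2, by rw [← h3, h.inv], h3, join_pair_left h1 h2 h3,
      join_bead_new h1 h2 (.inl h3)⟩)
  by_cases h4 : S.pair x = j
  · exact .inr (.inr (.inl ⟨h1, h2, by rw [← h4, h.inv], h4, join_pair_right h1 h2 hne h4,
      join_bead_new h1 h2 (.inr h4)⟩))
  exact .inr (.inr (.inr ⟨h1, h2, fun e => h3 (by rw [e, h.inv]), fun e => h4 (by rw [e, h.inv]),
    h3, h4, by simp [join, h1, h2, h3, h4], join_bead_other h1 h2 h3 h4⟩))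

theorem Valid.adj (h : S.Valid ty F dead) (hF : Function.Injective F.pos)
    (hij : Joinable F dead i j) {x : α} (h1 : x ≠ i) (h2 : x ≠ j) (h3 : S.pair x ≠ x) :
    F.pos x < F.pos i ∨ F.pos j < F.pos x := by
  by_contra hc
  push Not at hc
  have h4 : F.pos x ≠ F.pos i := fun e => h1 (hF e)
  have h5 : F.pos x ≠ F.pos j := fun e => h2 (hF e)
  exact h3 ((h.dead_iff x).2 (hij.between x (by omega) (by omega)))

theorem Valid.join_inv (h : S.Valid ty F dead) (hij : Joinable F dead i j) (x : α) :
    (S.join ty F i j).pair ((S.join ty F i j).pair x) = x := by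
  have hne : i ≠ j := fun e => by have := hij.lt; rw [e] at this; omega
  rcases h.cases hij x with h0 | ⟨h1, h2, h3, h4, h5, -⟩ | ⟨h1, h2, h3, h4, h5, -⟩ |
    ⟨h1, h2, h3, h4, h5, h6, h7, -⟩
  · rw [join_pair_self h0, join_pair_self h0]
  · rw [h5]
    rcases h.cases hij (S.pair j) with g0 | ⟨g1, g2, g3, g4, g5, -⟩ | ⟨g1, g2, g3, g4, g5, -⟩ |
      ⟨g1, g2, g3, g4, g5, g6, g7, -⟩
    · exfalso
      rcases g0 with g | g
      · apply h2; rw [h3, ← g, h.inv]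
      · exact hij.right ((h.dead_iff j).1 g)
    · rw [h.inv] at g4; exact absurd g4 hne.symm
    · rw [g5, h3]
    · exact absurd rfl g4
  · rw [h5]
    rcases h.cases hij (S.pair i) with g0 | ⟨g1, g2, g3, g4, g5, -⟩ | ⟨g1, g2, g3, g4, g5, -⟩ |
      ⟨g1, g2, g3, g4, g5, g6, g7, -⟩
    · exfalso
      rcases g0 with g | g
      · exact hij.left ((h.dead_iff i).1 g)
      · apply h1; rw [h3, ← g, h.inv]
    · rw [g5, h3]
    · rw [h.inv] at g4; exact absurd g4 hne
    · exact absurd rfl g3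
  · rw [h7]
    have e1 : S.pair (S.pair x) ≠ i := by rwa [h.inv]
    have e2 : S.pair (S.pair x) ≠ j := by rwa [h.inv]
    simp [join, h1, h2, h5, h6, h.inv]

theorem Valid.join_dead_iff (h : S.Valid ty F dead) (hij : Joinable F dead i j) (x : α) :
    (S.join ty F i j).pair x = x ↔ x ∈ insert i (insert j dead) := by
  rcases h.cases hij x with h0 | ⟨h1, h2, h3, h4, h5, -⟩ | ⟨h1, h2, h3, h4, h5, -⟩ |
    ⟨h1, h2, h3, h4, h5, h6, h7, -⟩
  · rw [join_pair_self h0]; simp; tauto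
  · have hx : x ∉ dead := fun hd => h1 (by rw [← (h.dead_iff x).2 hd]; exact h4)
    have : S.pair j ≠ x := fun e => by
      have hne : i ≠ j := fun e => by have := hij.lt; rw [e] at this; omega
      rw [h3] at e; have := congrArg S.pair e; rw [h.inv, h.inv] at this; exact hne this.symm
    rw [h5]; simp [h1, h2, hx, this]
  · have hx : x ∉ dead := fun hd => h2 (by rw [← (h.dead_iff x).2 hd]; exact h4)
    have : S.pair i ≠ x := fun e => by
      have hne : i ≠ j := fun e => by have := hij.lt; rw [e] at this; omega
      rw [h3] at e; have := congrArg S.pair e; rw [h.inv, h.inv] at this; exact hne this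
    rw [h5]; simp [h1, h2, hx, this]
  · rw [h7, h.dead_iff]; simp [h1, h2]

theorem Valid.join_nc (h : S.Valid ty F dead) (hF : Function.Injective F.pos)
    (hij : Joinable F dead i j) : (S.join ty F i j).NonCrossing F.pos := by
  have lt := hij.lt
  intro x y hxy hyx
  rcases h.cases hij y with h0 | ⟨h1, h2, h3, h4, h5, -⟩ | ⟨h1, h2, h3, h4, h5, -⟩ |
    ⟨h1, h2, h3, h4, h5, h6, h7, -⟩
  · rw [join_pair_self h0]; exact ⟨hxy, hyx⟩
  · rcases h.cases hij x with g0 | ⟨g1, g2, g3, g4, g5, -⟩ | ⟨g1, g2, g3, g4, g5, -⟩ |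
      ⟨g1, g2, g3, g4, g5, g6, g7, -⟩
    · rw [join_pair_self g0] at hyx; omega
    · rw [g3, ← h3] at hxy; omega
    · rw [g5, ← h3] at hyx; omega
    rw [g7] at hyx ⊢; rw [h5]
    have e := h.nc x y hxy hyx
    rw [h4] at e
    have a1 := h.adj hF hij g1 g2 (fun e => by rw [e] at hyx; omega)
    have a2 := h.adj hF hij g5 g6 (fun e => by rw [h.inv] at e; rw [← e] at hyx; omega)
    exact h.nc x j (by omega) (by omega)
  · rcases h.cases hij x with g0 | ⟨g1, g2, g3, g4, g5, -⟩ | ⟨g1, g2, g3, g4, g5, -⟩ |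
      ⟨g1, g2, g3, g4, g5, g6, g7, -⟩
    · rw [join_pair_self g0] at hyx; omega
    · rw [g5, ← h3] at hyx; omega
    · rw [g3, ← h3] at hxy; omega
    rw [g7] at hyx ⊢; rw [h5]
    have e := h.nc x y hxy hyx
    rw [h4] at e
    have a1 := h.adj hF hij g1 g2 (fun e => by rw [e] at hyx; omega)
    have a2 := h.adj hF hij g5 g6 (fun e => by rw [h.inv] at e; rw [← e] at hyx; omega)
    exact h.nc x i (by omega) (by omega)
  rw [h7]
  by_cases hyd : S.pair y = y
  · rw [hyd]; exact ⟨hxy, hyx⟩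
  have a1 := h.adj hF hij h1 h2 hyd
  have a2 := h.adj hF hij h5 h6 (by rw [h.inv]; exact fun e => hyd e.symm)
  have n1 := h.sep y i
  have n2 := h.sep y j
  have n3 := h.sep y (S.pair i)
  have n4 := h.sep y (S.pair j)
  rw [h.inv] at n3 n4
  have q1 : F.pos (S.pair y) ≠ F.pos (S.pair i) := fun e => by
    have := congrArg S.pair (hF e); rw [h.inv, h.inv] at this; exact h1 this
  have q2 : F.pos (S.pair y) ≠ F.pos (S.pair j) := fun e => by
    have := congrArg S.pair (hF e); rw [h.inv, h.inv] at this; exact h2 this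
  rcases h.cases hij x with g0 | ⟨g1, g2, g3, g4, g5, -⟩ | ⟨g1, g2, g3, g4, g5, -⟩ |
    ⟨g1, g2, g3, g4, g5, g6, g7, -⟩
  · rw [join_pair_self g0] at hyx; omega
  · rw [g5] at hyx ⊢; rw [g3] at hxy ⊢; omega
  · rw [g5] at hyx ⊢; rw [g3] at hxy ⊢; omega
  · rw [g7] at hyx ⊢; exact h.nc x y hxy hyx

theorem fuse_true {a b : α} {c d : Bool} (h : fuse ty F a b c d = true) : c = true ∨ d = true := by
  cases ty <;> cases c <;> cases d <;> simp_all [fuse]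

theorem Valid.join_exposed (h : S.Valid ty F dead) (hF : Function.Injective F.pos)
    (hij : Joinable F dead i j) (x : α) (hx : (S.join ty F i j).bead x = true) :
    (S.join ty F i j).Exposed F.pos x := by
  have lt := hij.lt
  rintro y ⟨c1, c2, c3, c4⟩
  rcases h.cases hij y with h0 | ⟨h1, h2, h3, h4, h5, -⟩ | ⟨h1, h2, h3, h4, h5, -⟩ |
    ⟨h1, h2, h3, h4, h5, h6, h7, -⟩
  · rw [join_pair_self h0] at c3; omega
  · rcases h.cases hij x with g0 | ⟨g1, g2, g3, g4, g5, -⟩ | ⟨g1, g2, g3, g4, g5, -⟩ |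
      ⟨g1, g2, g3, g4, g5, g6, g7, g8⟩
    · rw [join_bead_self g0] at hx; cases hx
    · rw [h3, ← g3] at c1; omega
    · rw [g5, ← h3] at c2; omega
    rw [g8] at hx
    have ex := h.exposed x hx
    rw [h5] at c3 c4; rw [g7] at c2 c4; rw [h3] at c1 c2
    have e1 := ex i
    have e2 := ex j
    have e3 := ex (S.pair i)
    have e4 := ex (S.pair j)
    have n1 := h.sep i x
    have n2 := h.sep j x
    rw [h.inv] at e3 e4
    by_cases hd : S.pair x = x
    · rw [h.bead_dead x ((h.dead_iff x).1 hd)] at hx; cases hx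
    have a1 := h.adj hF hij g1 g2 hd
    omega
  · rcases h.cases hij x with g0 | ⟨g1, g2, g3, g4, g5, -⟩ | ⟨g1, g2, g3, g4, g5, -⟩ |
      ⟨g1, g2, g3, g4, g5, g6, g7, g8⟩
    · rw [join_bead_self g0] at hx; cases hx
    · rw [g5, ← h3] at c2; omega
    · rw [h3, ← g3] at c1; omega
    rw [g8] at hx
    have ex := h.exposed x hx
    rw [h5] at c3 c4; rw [g7] at c2 c4; rw [h3] at c1 c2
    have e1 := ex i
    have e2 := ex j
    have e3 := ex (S.pair i)
    have e4 := ex (S.pair j)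
    have n1 := h.sep i x
    have n2 := h.sep j x
    rw [h.inv] at e3 e4
    by_cases hd : S.pair x = x
    · rw [h.bead_dead x ((h.dead_iff x).1 hd)] at hx; cases hx
    have a1 := h.adj hF hij g1 g2 hd
    omega
  · rw [h7] at c3 c4
    have key : (F.pos y < F.pos (S.pair i) ∧ F.pos (S.pair i) < F.pos (S.pair y)) →
        (F.pos y < F.pos (S.pair j) ∧ F.pos (S.pair j) < F.pos (S.pair y)) →
        S.bead i = true ∨ S.bead j = true → False := by
      intro k1 k2 k3
      have n1 := h.nc y (S.pair i) k1.1 k1.2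
      have n2 := h.nc y (S.pair j) k2.1 k2.2
      rw [h.inv] at n1 n2
      rcases k3 with k3 | k3
      · exact h.exposed i k3 y ⟨n1.1, k1.1, n1.2, k1.2⟩
      · exact h.exposed j k3 y ⟨n2.1, k2.1, n2.2, k2.2⟩
    rcases h.cases hij x with g0 | ⟨g1, g2, g3, g4, g5, g6⟩ | ⟨g1, g2, g3, g4, g5, g6⟩ |
      ⟨g1, g2, g3, g4, g5, g6, g7, g8⟩
    · rw [join_bead_self g0] at hx; cases hx
    · rw [g5] at c2 c4; rw [g3] at c1 c3; rw [g6] at hx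
      exact key ⟨c1, c3⟩ ⟨c2, c4⟩ (fuse_true hx)
    · rw [g5] at c2 c4; rw [g3] at c1 c3; rw [g6] at hx
      exact key ⟨c2, c4⟩ ⟨c1, c3⟩ (fuse_true hx)
    · rw [g7] at c2 c4; rw [g8] at hx
      exact h.exposed x hx y ⟨c1, c2, c3, c4⟩

theorem Joinable.inward (hij : Joinable F dead i j) (hm : F.mark i ≠ .circ) :
    F.Inward i ↔ ¬ F.Inward j := by
  have m := hij.mark
  rw [m] at hm
  simp only [Frame.Inward, hij.south_left, hij.south_right, m]
  cases h3 : F.mark j <;> simp_all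

theorem fuse_oriented (hij : Joinable F dead i j) (h : S.Valid ty F dead)
    (hf : fuse ty F (S.pair i) (S.pair j) (S.bead i) (S.bead j) = false) :
    F.Oriented (S.pair i) (S.pair j) := by
  have o1 := h.oriented i hij.left
  have o2 := h.oriented j hij.right
  have m := hij.mark
  have w := hij.inward
  unfold Frame.Oriented at *
  cases ty with
  | C =>
    have c1 := h.circ rfl i hij.left
    have c2 := h.circ rfl j hij.right
    simp only [fuse] at hf
    split_ifs at hf with hm
    · exact .inl hm.1
    · simp only [Bool.or_eq_false_iff] at hf
      rw [hf.1] at c1 o1; rw [hf.2] at c2 o2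
      grind
  | D =>
    have n1 := h.noCirc rfl i
    have n2 := h.noCirc rfl j
    have n3 := h.noCirc rfl (S.pair i)
    have n4 := h.noCirc rfl (S.pair j)
    have f1 := h.flip rfl i
    have f2 := h.flip rfl j
    unfold Frame.FlipOriented at *
    simp only [fuse, n3, false_and, if_false] at hf
    have w := w n1
    cases h1 : S.bead i <;> cases h2 : S.bead j <;>
      simp only [h1, h2, n1, n2, n3, n4, false_or] at * <;> grind

theorem fuse_flip (hij : Joinable F dead i j) (h : S.Valid .D F dead)
    (hf : fuse .D F (S.pair i) (S.pair j) (S.bead i) (S.bead j) = true) :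
    F.FlipOriented (S.pair i) (S.pair j) := by
  have o1 := h.oriented i hij.left
  have o2 := h.oriented j hij.right
  have n1 := h.noCirc rfl i
  have n2 := h.noCirc rfl j
  have n3 := h.noCirc rfl (S.pair i)
  have n4 := h.noCirc rfl (S.pair j)
  have f1 := h.flip rfl i
  have f2 := h.flip rfl j
  have w := hij.inward n1
  unfold Frame.FlipOriented Frame.Oriented at *
  simp only [fuse, n3, false_and, if_false] at hf
  cases h1 : S.bead i <;> cases h2 : S.bead j <;>
    simp only [h1, h2, n1, n2, n3, n4, false_or] at * <;> grind

theorem Valid.not_dead_pair (h : S.Valid ty F dead) {x : α} (hx : x ∉ dead) : S.pair x ∉ dead := by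
  rw [← h.dead_iff] at hx ⊢
  rw [h.inv]; exact fun e => hx e.symm

theorem fuse_circ (hij : Joinable F dead i j) (h : S.Valid .C F dead) :
    (F.mark (S.pair i) = .circ →
      (fuse .C F (S.pair i) (S.pair j) (S.bead i) (S.bead j) = true ↔ F.mark (S.pair j) ≠ .circ)) ∧
    (F.mark (S.pair j) = .circ →
      (fuse .C F (S.pair i) (S.pair j) (S.bead i) (S.bead j) = true ↔ F.mark (S.pair i) ≠ .circ)) := by
  have c1 := h.circ rfl i hij.left
  have c2 := h.circ rfl j hij.right
  have c3 := h.circ rfl (S.pair i) (h.not_dead_pair hij.left)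
  have c4 := h.circ rfl (S.pair j) (h.not_dead_pair hij.right)
  rw [h.inv, h.bead_pair] at c3 c4
  have m := hij.mark
  simp only [fuse]
  grind

theorem Valid.join (h : S.Valid ty F dead) (hF : Function.Injective F.pos)
    (hij : Joinable F dead i j) : (S.join ty F i j).Valid ty F (insert i (insert j dead)) where
  inv := h.join_inv hij
  dead_iff := h.join_dead_iff hij
  nc := h.join_nc hF hij
  exposed := h.join_exposed hF hij
  noCirc := h.noCirc
  bead_pair x := by
    rcases h.cases hij x with g0 | ⟨g1, g2, g3, g4, g5, g6⟩ | ⟨g1, g2, g3, g4, g5, g6⟩ |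
      ⟨g1, g2, g3, g4, g5, g6, g7, g8⟩
    · rw [join_pair_self g0]
    · rw [g6, g5]
      refine join_bead_new ?_ ?_ (.inr (h.inv j))
      · exact fun e => g2 (by rw [g3, ← e, h.inv])
      · exact fun e => hij.right ((h.dead_iff j).1 e)
    · rw [g6, g5]
      refine join_bead_new ?_ ?_ (.inl (h.inv i))
      · exact fun e => hij.left ((h.dead_iff i).1 e)
      · exact fun e => g1 (by rw [g3, ← e, h.inv])
    · rw [g8, g7, join_bead_other g5 g6 (by rwa [h.inv]) (by rwa [h.inv]), h.bead_pair]
  bead_dead x hx := by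
    by_cases h0 : x = i ∨ x = j
    · exact join_bead_self h0
    have hx : x ∈ dead := by simpa [not_or.1 h0] using hx
    have e := (h.dead_iff x).2 hx
    rw [join_bead_other (fun e => h0 (.inl e)) (fun e => h0 (.inr e)) (fun g => h0 (.inl (e ▸ g)))
      (fun g => h0 (.inr (e ▸ g)))]
    exact h.bead_dead x hx
  oriented x hx hb := by
    rcases h.cases hij x with g0 | ⟨g1, g2, g3, g4, g5, g6⟩ | ⟨g1, g2, g3, g4, g5, g6⟩ |
      ⟨g1, g2, g3, g4, g5, g6, g7, g8⟩
    · exact absurd (by simpa using Or.imp_right Or.inl g0) hx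
    · rw [g6] at hb; rw [g5, g3]; exact fuse_oriented hij h hb
    · rw [g6] at hb; rw [g5, g3]; exact (fuse_oriented hij h hb).symm
    · rw [g8] at hb; rw [g7]; exact h.oriented x (fun e => hx (by simp [e])) hb
  flip hD x hb := by
    subst hD
    rcases h.cases hij x with g0 | ⟨g1, g2, g3, g4, g5, g6⟩ | ⟨g1, g2, g3, g4, g5, g6⟩ |
      ⟨g1, g2, g3, g4, g5, g6, g7, g8⟩
    · rw [join_bead_self g0] at hb; cases hb
    · rw [g6] at hb; rw [g5, g3]; exact fuse_flip hij h hb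
    · rw [g6] at hb; rw [g5, g3]; exact (fuse_flip hij h hb).symm
    · rw [g8] at hb; rw [g7]; exact h.flip rfl x hb
  circ hC x hx hm := by
    subst hC
    rcases h.cases hij x with g0 | ⟨g1, g2, g3, g4, g5, g6⟩ | ⟨g1, g2, g3, g4, g5, g6⟩ |
      ⟨g1, g2, g3, g4, g5, g6, g7, g8⟩
    · exact absurd (by simpa using Or.imp_right Or.inl g0) hx
    · rw [g6, g5]; rw [g3] at hm; exact (fuse_circ hij h).1 hm
    · rw [g6, g5]; rw [g3] at hm; exact (fuse_circ hij h).2 hm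
    · rw [g8, g7]; exact h.circ rfl x (fun e => hx (by simp [e])) hm

theorem fuse_comm (a b : α) (c d : Bool) : fuse ty F a b c d = fuse ty F b a d c := by
  cases ty <;> simp [fuse, Bool.or_comm, Bool.xor_comm, and_comm]

theorem fuse_assoc {a k m c : α} {x y z : Bool}
    (h1 : ty = .C → F.mark a = .circ → F.mark k = .circ → F.mark c ≠ .circ → z = true)
    (h2 : ty = .C → F.mark m = .circ → F.mark c = .circ → F.mark a ≠ .circ → x = true)
    (h3 : ty = .D → ∀ x, F.mark x ≠ .circ) :
    fuse ty F a c (fuse ty F a k x y) z = fuse ty F a c x (fuse ty F m c y z) := by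
  cases ty with
  | C =>
    simp only [fuse, true_implies] at *
    by_cases ha : F.mark a = .circ <;> by_cases hc : F.mark c = .circ <;>
      by_cases hk : F.mark k = .circ <;> by_cases hm : F.mark m = .circ <;>
      simp_all [Bool.or_assoc]
  | D =>
    have h := h3 rfl
    simp [fuse, h, Bool.xor_assoc]

theorem join_symm (hij : i ≠ j) : S.join ty F i j = S.join ty F j i := by
  simp only [join, Config.mk.injEq]
  constructor
  · funext x; split_ifs <;> grind
  · funext x; rw [fuse_comm (ty := ty) (F := F) (S.pair i)]; split_ifs <;> grind

theorem join_comm_pair {k l : α} (inv : ∀ x, S.pair (S.pair x) = x)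
    (h1 : i ≠ j) (h2 : i ≠ k) (h3 : i ≠ l) (h4 : j ≠ k) (h5 : j ≠ l) (h6 : k ≠ l)
    (x : α) :
    ((S.join ty F i j).join ty F k l).pair x = ((S.join ty F k l).join ty F i j).pair x := by
  have i1 := inv i
  have i2 := inv j
  have i3 := inv k
  have i4 := inv l
  have i5 := inv x
  clear inv
  simp only [join]
  grind

theorem join_comm_bead_aux {k l : α} (h : S.Valid ty F dead)
    (h1 : i ≠ j) (h2 : i ≠ k) (h3 : i ≠ l) (h4 : j ≠ k) (h5 : j ≠ l) (h6 : k ≠ l)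
    (f1 : i ∉ dead) (f2 : j ∉ dead) (f3 : k ∉ dead) (f4 : l ∉ dead)
    (m1 : F.mark i = F.mark j) (m2 : F.mark k = F.mark l) (hjk : S.pair j = k) (x : α) :
    ((S.join ty F i j).join ty F k l).bead x = ((S.join ty F k l).join ty F i j).bead x := by
  have hkj : S.pair k = j := by rw [← hjk, h.inv]
  have as : fuse ty F (S.pair i) (S.pair l)
      (fuse ty F (S.pair i) k (S.bead i) (S.bead j)) (S.bead l) =
      fuse ty F (S.pair i) (S.pair l) (S.bead i)
        (fuse ty F j (S.pair l) (S.bead k) (S.bead l)) := by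
    rw [← hjk, h.bead_pair]
    have c1 := fun e => h.circ e i f1
    have c4 := fun e => h.circ e l f4
    have d1 := fun e => h.circ e _ (h.not_dead_pair f1)
    have d4 := fun e => h.circ e _ (h.not_dead_pair f4)
    rw [h.inv, h.bead_pair] at d1 d4
    refine fuse_assoc ?_ ?_ h.noCirc
    · intro e e1 e2 e3
      rw [hjk, m2] at e2
      exact (c4 e e2).2 e3
    · intro e e1 e2 e3
      rw [← m1] at e1
      exact (c1 e e1).2 e3
  have i1 := h.inv i
  have i4 := h.inv l
  have i5 := h.inv x
  have b5 := h.bead_pair x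
  have g1 := mt (h.dead_iff i).1 f1
  have g4 := mt (h.dead_iff l).1 f4
  clear h f1 f2 f3 f4
  have p1 : (S.join ty F i j).pair k = S.pair i := by simp only [join]; grind
  have p2 : (S.join ty F k l).pair j = S.pair l := by simp only [join]; grind
  have q1 : (S.join ty F i j).bead k = fuse ty F (S.pair i) k (S.bead i) (S.bead j) := by
    simp only [join]; grind
  have q2 : (S.join ty F k l).bead j = fuse ty F j (S.pair l) (S.bead k) (S.bead l) := by
    simp only [join]; grind
  by_cases hil : S.pair i = l
  · have hli : S.pair l = i := by rw [← hil, i1]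
    simp only [join]; grind
  have p3 : (S.join ty F i j).pair l = S.pair l := by simp only [join]; grind
  have p4 : (S.join ty F k l).pair i = S.pair i := by simp only [join]; grind
  have q3 : (S.join ty F i j).bead l = S.bead l := by simp only [join]; grind
  have q4 : (S.join ty F k l).bead i = S.bead i := by simp only [join]; grind
  by_cases hx : x = i ∨ x = j ∨ x = k ∨ x = l
  · simp only [join]; grind
  by_cases hx2 : x = S.pair i ∨ x = S.pair l
  · have e1 : ((S.join ty F i j).join ty F k l).bead x = fuse ty F (S.pair i) (S.pair l)
      (fuse ty F (S.pair i) k (S.bead i) (S.bead j)) (S.bead l) := by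
      rw [join_bead_new (by grind) (by grind) (by simp only [join]; grind), p1, p3, q1, q3]
    have e2 : ((S.join ty F k l).join ty F i j).bead x = fuse ty F (S.pair i) (S.pair l) (S.bead i)
        (fuse ty F j (S.pair l) (S.bead k) (S.bead l)) := by
      rw [join_bead_new (by grind) (by grind) (by simp only [join]; grind), p2, p4, q2, q4]
    rw [e1, e2, as]
  · simp only [join]; grind

theorem join_comm_bead {k l : α} (h : S.Valid ty F dead)
    (h1 : i ≠ j) (h2 : i ≠ k) (h3 : i ≠ l) (h4 : j ≠ k) (h5 : j ≠ l) (h6 : k ≠ l)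
    (f1 : i ∉ dead) (f2 : j ∉ dead) (f3 : k ∉ dead) (f4 : l ∉ dead)
    (m1 : F.mark i = F.mark j) (m2 : F.mark k = F.mark l) (x : α) :
    ((S.join ty F i j).join ty F k l).bead x = ((S.join ty F k l).join ty F i j).bead x := by
  by_cases hjk : S.pair j = k
  · exact join_comm_bead_aux h h1 h2 h3 h4 h5 h6 f1 f2 f3 f4 m1 m2 hjk x
  by_cases hik : S.pair i = k
  · rw [join_symm h1, join_symm (S := S.join ty F k l) h1]
    exact join_comm_bead_aux h h1.symm h4 h5 h2 h3 h6 f2 f1 f3 f4 m1.symm m2 hik x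
  by_cases hjl : S.pair j = l
  · rw [join_symm h6, join_symm (S := S) h6]
    exact join_comm_bead_aux h h1 h3 h2 h5 h4 h6.symm f1 f2 f4 f3 m1 m2.symm hjl x
  by_cases hil : S.pair i = l
  · rw [join_symm h1, join_symm (S := S.join ty F k l) h1, join_symm h6, join_symm (S := S) h6]
    exact join_comm_bead_aux h h1.symm h5 h4 h3 h2 h6.symm f2 f1 f4 f3 m1.symm m2.symm hil x
  have i1 := h.inv i
  have i2 := h.inv j
  have i3 := h.inv k
  have i4 := h.inv l
  have i5 := h.inv x
  clear h f1 f2 f3 f4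
  simp only [join]
  grind

theorem join_comm {k l : α} (h : S.Valid ty F dead) (hij : Joinable F dead i j)
    (hkl : Joinable F dead k l) (hjk : F.pos j < F.pos k) :
    (S.join ty F i j).join ty F k l = (S.join ty F k l).join ty F i j := by
  have lt1 := hij.lt
  have lt2 := hkl.lt
  have ne : ∀ {x y : α}, F.pos x < F.pos y → x ≠ y := fun h e => by rw [e] at h; omega
  have h1 := ne lt1
  have h2 : i ≠ k := ne (by omega)
  have h3 : i ≠ l := ne (by omega)
  have h4 : j ≠ k := ne (by omega)
  have h5 : j ≠ l := ne (by omega)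
  have h6 := ne lt2
  have e1 := funext (join_comm_pair (ty := ty) (F := F) h.inv h1 h2 h3 h4 h5 h6)
  have e2 := funext (join_comm_bead h h1 h2 h3 h4 h5 h6 hij.left hij.right hkl.left hkl.right
    hij.mark hkl.mark)
  exact Config.ext e1 e2

theorem loopDegree_comm {k l : α} (h : S.Valid ty F dead) (hij : Joinable F dead i j)
    (hkl : Joinable F dead k l) (hjk : F.pos j < F.pos k) :
    loopDegree F S i j + loopDegree F (S.join ty F i j) k l =
      loopDegree F S k l + loopDegree F (S.join ty F k l) i j := by
  have lt1 := hij.lt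
  have lt2 := hkl.lt
  have ne : ∀ {x y : α}, F.pos x < F.pos y → x ≠ y := fun h e => by rw [e] at h; omega
  have h1 := ne lt1
  have h2 : i ≠ k := ne (by omega)
  have h3 : i ≠ l := ne (by omega)
  have h4 : j ≠ k := ne (by omega)
  have h5 : j ≠ l := ne (by omega)
  have h6 := ne lt2
  have i1 := h.inv i
  have i2 := h.inv j
  have i3 := h.inv k
  have i4 := h.inv l
  have cross : ¬ S.pair i = k ∨ ¬ S.pair j = l := by
    by_contra hc
    push Not at hc
    have := h.nc i j lt1 (by rw [hc.1]; exact hjk)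
    rw [hc.1, hc.2] at this; omega
  have nest : S.pair i = l → S.pair j = k → F.mark i = F.mark k := by
    intro e1 e2
    have hb : S.bead j = false := by
      by_contra hb
      refine h.exposed j (by simpa using hb) i ?_
      rw [e1, e2]; omega
    have o := h.oriented j hij.right hb
    have c := fun e => h.circ e j hij.right
    have n := fun e => h.noCirc e j
    have n2 := fun e => h.noCirc e k
    rw [e2, hb] at c
    rw [e2] at o
    have s1 := hij.south_right
    have s2 := hkl.south_left
    have m := hij.mark
    unfold Frame.Oriented Frame.Inward at o
    have d := fun e => h.circ e k hkl.left
    rw [← e2, h.inv, h.bead_pair, hb, e2] at d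
    cases ty <;> cases hm1 : F.mark j <;> cases hm2 : F.mark k <;> simp_all
  unfold loopDegree
  simp only [join]
  grind

/-! Joining a whole list of pairs of points, from the head of the list on. -/

/-- Glue all pairs of points in the list, from the head of the list on. -/
def joinAll (ty : PairType) (F : Frame α) : List (α × α) → Config α → Config α
  | [], S => S
  | p :: l, S => joinAll ty F l (S.join ty F p.1 p.2)

/-- The exponent of `q` contributed by all the closed loops that arise in `joinAll`. -/
def loopTotal (ty : PairType) (F : Frame α) : List (α × α) → Config α → ℤ
  | [], _ => 0
  | p :: l, S => loopDegree F S p.1 p.2 + loopTotal ty F l (S.join ty F p.1 p.2)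

/-- All pairs of the list can be glued in turn (used in proofs only). -/
def Nested (F : Frame α) : Set α → List (α × α) → Prop
  | _, [] => True
  | dead, p :: l => Joinable F dead p.1 p.2 ∧ Nested F (insert p.1 (insert p.2 dead)) l

/-- The points that are gone after gluing (used in proofs only). -/
def deadAfter : Set α → List (α × α) → Set α
  | dead, [] => dead
  | dead, p :: l => deadAfter (insert p.1 (insert p.2 dead)) l

theorem mem_deadAfter {x : α} (l : List (α × α)) : ∀ dead : Set α,
    x ∈ deadAfter dead l ↔ x ∈ dead ∨ ∃ p ∈ l, x = p.1 ∨ x = p.2 := by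
  induction l with
  | nil => intro dead; simp [deadAfter]
  | cons p l ih =>
    intro dead
    rw [deadAfter, ih]
    simp only [Set.mem_insert_iff, List.mem_cons, exists_eq_or_imp]
    grind

theorem Valid.joinAll (hF : Function.Injective F.pos) (l : List (α × α)) :
    ∀ {dead : Set α} {S : Config α}, S.Valid ty F dead → Nested F dead l →
      (S.joinAll ty F l).Valid ty F (deadAfter dead l) := by
  induction l with
  | nil => intro dead S h _; exact h
  | cons p l ih => intro dead S h hl; exact ih (h.join hF hl.1) hl.2

theorem Joinable.union (h : Joinable F dead i j) {E : Set α} (h1 : i ∉ E) (h2 : j ∉ E) :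
    Joinable F (dead ∪ E) i j where
  lt := h.lt
  left := by simp [h.left, h1]
  right := by simp [h.right, h2]
  between x hx hx' := .inl (h.between x hx hx')
  south_left := h.south_left
  south_right := h.south_right
  mark := h.mark

theorem Nested.union (E : Set α) (l : List (α × α)) : ∀ {dead : Set α}, Nested F dead l →
    (∀ p ∈ l, p.1 ∉ E ∧ p.2 ∉ E) → Nested F (dead ∪ E) l := by
  induction l with
  | nil => intro dead _ _; trivial
  | cons p l ih =>
    intro dead h hE
    have hp := hE p (by simp)
    refine ⟨h.1.union hp.1 hp.2, ?_⟩
    have := ih h.2 (fun q hq => hE q (by simp [hq]))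
    rwa [Set.insert_union, Set.insert_union] at this

theorem Nested.insert (l : List (α × α)) {dead : Set α} (h : Nested F dead l) {a b : α}
    (hE : ∀ p ∈ l, p.1 ≠ a ∧ p.1 ≠ b ∧ p.2 ≠ a ∧ p.2 ≠ b) :
    Nested F (insert a (insert b dead)) l := by
  have := h.union {a, b} l (fun p hp => by have := hE p hp; simp; tauto)
  convert this using 1
  ext x; simp

theorem Nested.lt (l : List (α × α)) : ∀ {dead : Set α}, Nested F dead l →
    ∀ p ∈ l, F.pos p.1 < F.pos p.2 := by
  induction l with
  | nil => simp
  | cons q l ih =>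
    intro dead h p hp
    rcases List.mem_cons.1 hp with rfl | hp
    · exact h.1.lt
    · exact ih h.2 p hp

theorem joinAll_comm_single (hF : Function.Injective F.pos) (k m : α) (l : List (α × α)) :
    ∀ {dead : Set α} {S : Config α}, S.Valid ty F dead → Nested F dead l →
      Joinable F dead k m → (∀ p ∈ l, F.pos p.2 < F.pos k) →
      (S.join ty F k m).joinAll ty F l = (S.joinAll ty F l).join ty F k m ∧
      loopDegree F S k m + (S.join ty F k m).loopTotal ty F l =
        S.loopTotal ty F l + loopDegree F (S.joinAll ty F l) k m := by
  induction l with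
  | nil => intro dead S h _ _ _; simp [Config.joinAll, loopTotal]
  | cons p l ih =>
    intro dead S h hl hk hlt
    have hp := hlt p (by simp)
    have c1 := join_comm h hl.1 hk hp
    have c2 := loopDegree_comm h hl.1 hk hp
    have pl := hl.1.lt
    have kl := hk.lt
    have ne : ∀ {x y : α}, F.pos y < F.pos x → x ≠ y := fun h e => by rw [e] at h; omega
    have hk' : Joinable F (insert p.1 (insert p.2 dead)) k m :=
      { hk with
        left := by simp [hk.left, ne hp, ne (pl.trans hp)]
        right := by simp [hk.right, ne (hp.trans kl), ne (pl.trans (hp.trans kl))]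
        between := fun x h1 h2 => .inr (.inr (hk.between x h1 h2)) }
    have := ih (h.join hF hl.1) hl.2 hk' (fun q hq => hlt q (by simp [hq]))
    simp only [Config.joinAll, loopTotal]
    rw [← c1]
    refine ⟨this.1, ?_⟩
    linarith [this.2]

theorem joinAll_comm (hF : Function.Injective F.pos) (l l' : List (α × α)) :
    ∀ {dead : Set α} {S : Config α}, S.Valid ty F dead → Nested F dead l → Nested F dead l' →
      (∀ p ∈ l, ∀ q ∈ l', F.pos p.2 < F.pos q.1) →
      (S.joinAll ty F l').joinAll ty F l = (S.joinAll ty F l).joinAll ty F l' ∧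
      S.loopTotal ty F l' + (S.joinAll ty F l').loopTotal ty F l =
        S.loopTotal ty F l + (S.joinAll ty F l).loopTotal ty F l' := by
  induction l' with
  | nil => intro dead S h _ _ _; simp [Config.joinAll, loopTotal]
  | cons q l' ih =>
    intro dead S h hl hl' hlt
    have c := joinAll_comm_single hF q.1 q.2 l h hl hl'.1 (fun p hp => hlt p hp q (by simp))
    have ne : ∀ {x y : α}, F.pos x < F.pos y → x ≠ y := fun h e => by rw [e] at h; omega
    have ql := hl'.1.lt
    have hl2 : Nested F (insert q.1 (insert q.2 dead)) l := hl.insert l (fun p hp => by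
      have h1 := hl.lt l p hp
      have h2 := hlt p hp q (by simp)
      exact ⟨ne (h1.trans h2), ne (h1.trans (h2.trans ql)), ne h2, ne (h2.trans ql)⟩)
    have := ih (h.join hF hl'.1) hl2 hl'.2 (fun p hp r hr => hlt p hp r (by simp [hr]))
    simp only [Config.joinAll, loopTotal]
    rw [← c.1]
    refine ⟨this.1, ?_⟩
    have e := this.2
    linarith [c.2]

/-! Transporting joins along an embedding of the set of points. -/

/-- `f` embeds the strands of `S` into those of `S'` (used in proofs only). -/
def Tracks {β : Type} (f : α → β) (S : Config α) (S' : Config β) : Prop :=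
  ∀ x, S'.pair (f x) = f (S.pair x) ∧ S'.bead (f x) = S.bead x

section Tracks
variable {β : Type} [DecidableEq β] {f : α → β} {G : Frame β} {S' : Config β}

theorem Tracks.join (h : Tracks f S S') (hf : Function.Injective f)
    (hm : ∀ x, G.mark (f x) = F.mark x) :
    Tracks f (S.join ty F i j) (S'.join ty G (f i) (f j)) := by
  intro x
  have hi := h i
  have hj := h j
  simp only [Config.join, (h x).1, (h x).2, hi.1, hi.2, hj.1, hj.2, hf.eq_iff]
  constructor
  · split_ifs <;> rfl
  · split_ifs <;> simp [fuse, hm]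

theorem Tracks.loopDegree (h : Tracks f S S') (hf : Function.Injective f)
    (hm : ∀ x, G.mark (f x) = F.mark x) :
    Config.loopDegree G S' (f i) (f j) = Config.loopDegree F S i j := by
  simp only [Config.loopDegree, (h i).1, hf.eq_iff, hm]

theorem Tracks.join_out (h : Tracks f S S') {a b : β} (ha : ∀ x, f x ≠ a) (hb : ∀ x, f x ≠ b) :
    Tracks f S (S'.join ty G a b) := by
  intro x
  simp [Config.join, (h x).1, (h x).2, ha, hb]

theorem Tracks.joinAll (hf : Function.Injective f) (hm : ∀ x, G.mark (f x) = F.mark x)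
    (l : List (α × α)) : ∀ {S : Config α} {S' : Config β}, Tracks f S S' →
    Tracks f (S.joinAll ty F l) (S'.joinAll ty G (l.map (Prod.map f f))) ∧
    S'.loopTotal ty G (l.map (Prod.map f f)) = S.loopTotal ty F l := by
  induction l with
  | nil => intro S S' h; exact ⟨h, rfl⟩
  | cons p l ih =>
    intro S S' h
    have := ih (h.join (i := p.1) (j := p.2) (ty := ty) hf hm)
    refine ⟨this.1, ?_⟩
    simp only [List.map_cons, loopTotal, Prod.map]
    rw [h.loopDegree hf hm]
    exact congrArg _ this.2

theorem Tracks.joinAll_out (l : List (β × β)) (hl : ∀ p ∈ l, ∀ x, f x ≠ p.1 ∧ f x ≠ p.2) :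
    ∀ {S : Config α} {S' : Config β}, Tracks f S S' →
    Tracks f S (S'.joinAll ty G l) := by
  induction l with
  | nil => intro S S' h; exact h
  | cons p l ih =>
    intro S S' h
    exact ih (fun q hq => hl q (by simp [hq]))
      (h.join_out (fun x => (hl p (by simp) x).1) (fun x => (hl p (by simp) x).2))

end Tracks

end Config

open Config Sum

/-- The vertices of an `(n+1)`-tangle: `inl k` is the `k`-th northern one, `inr k` the `k`-th southern one,
both counted from left to right, starting with `0`. -/
abbrev Vertex (n : ℕ) : Type := Fin (n + 1) ⊕ Fin (n + 1)

/-- Position of a vertex in the clockwise traversal of the boundary from its left-hand side: the northern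
vertices from left to right, then the southern ones from right to left. -/
def vertexPos {n : ℕ} : Vertex n → ℕ
  | .inl k => k
  | .inr k => 2 * n + 1 - k

/-- The coset diagrams. For `(C_n, A_{n-1})` the first label is `∘` and the others are arrows; for
`(D_{n+1}, A_n)` all labels are arrows and the number of `∧` is even. -/
def IsCoset {n : ℕ} : PairType → (Fin (n + 1) → Mark) → Prop
  | .C, l => l 0 = .circ ∧ ∀ k, k ≠ 0 → l k ≠ .circ
  | .D, l => (∀ k, l k ≠ .circ) ∧ Even (Finset.univ.filter (fun k => l k = .wedge)).card

/-- The set of coset diagrams of the pair. -/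
def Coset (ty : PairType) (n : ℕ) : Type := {l : Fin (n + 1) → Mark // IsCoset ty l}

noncomputable instance (ty : PairType) (n : ℕ) : Fintype (Coset ty n) := by
  classical
  unfold Coset
  infer_instance

/-- The frame whose northern vertices are labelled by `l` and whose southern vertices by `m`. -/
def boundary {n : ℕ} (l m : Fin (n + 1) → Mark) : Frame (Vertex n) where
  pos := vertexPos
  south := Sum.isRight
  mark := Sum.elim l m

/-- Loop-free decorated `(n+1)`-tangles with at most one bead on each strand, up to isotopy: non-crossing
perfect matchings of the vertices with beads on left exposed strands only. -/
structure IsTangle {n : ℕ} (d : Config (Vertex n)) : Prop where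
  pair_pair : ∀ v, d.pair (d.pair v) = v
  pair_ne : ∀ v, d.pair v ≠ v
  nonCrossing : d.NonCrossing vertexPos
  bead_pair : ∀ v, d.bead (d.pair v) = d.bead v
  exposed : ∀ v, d.bead v = true → d.Exposed vertexPos v

/-- The further condition for a loop-free decorated tangle to belong to the diagram basis of the
generalised Temperley--Lieb algebra of type `C_n`, respectively `D_{n+1}`.
In type `C`: the first northern and southern vertices are joined by an undecorated strand; or they are
joined by a decorated strand, and there is a northern and a southern arc; or they lie on two different
strands, both decorated. In type `D`: the number of decorated strands is even. -/
def InDT {n : ℕ} : PairType → Config (Vertex n) → Prop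
  | .C, d =>
    (d.pair (inl 0) = inr 0 ∧ d.bead (inl 0) = false) ∨
    (d.pair (inl 0) = inr 0 ∧ d.bead (inl 0) = true ∧
      (∃ j k, d.pair (inl j) = inl k) ∧ ∃ j k, d.pair (inr j) = inr k) ∨
    (d.pair (inl 0) ≠ inr 0 ∧ d.bead (inl 0) = true ∧ d.bead (inr 0) = true)
  | .D, d =>
    Even (Finset.univ.filter (fun v => d.bead v = true ∧ vertexPos v < vertexPos (d.pair v))).card

/-- The oriented tangles `λ d μ` of the pair: `top` is `λ`, `bot` is `μ` and `diag` is `d`. All undecorated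
strands are oriented. In type `D` all decorated strands are flip-oriented. In type `C` a strand
between two vertices labelled `∘` is undecorated. -/
@[ext]
structure ODT (ty : PairType) (n : ℕ) where
  top : Coset ty n
  bot : Coset ty n
  diag : Config (Vertex n)
  isTangle : IsTangle diag
  inDT : InDT ty diag
  oriented : ∀ v, diag.bead v = false →
    (boundary top.1 bot.1).Oriented v (diag.pair v)
  flipOriented : ty = .D → ∀ v, diag.bead v = true →
    (boundary top.1 bot.1).FlipOriented v (diag.pair v)
  noBead : ty = .C → ∀ v, (boundary top.1 bot.1).mark v = .circ →
    (boundary top.1 bot.1).mark (diag.pair v) = .circ → diag.bead v = false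

variable {ty : PairType} {n : ℕ}

theorem vertexPos_lt (v : Vertex n) : vertexPos v < 2 * (n + 1) := by
  rcases v with k | k <;> simp [vertexPos] <;> omega

theorem vertexPos_injective : Function.Injective (vertexPos (n := n)) := by
  rintro (⟨a, ha⟩ | ⟨a, ha⟩) (⟨b, hb⟩ | ⟨b, hb⟩) h <;> simp [vertexPos] at h ⊢ <;> omega

theorem boundary_circ {l m : Coset .C n} {v : Vertex n} :
    (boundary l.1 m.1).mark v = .circ ↔ v = inl 0 ∨ v = inr 0 := by
  rcases v with k | k
  · simp only [boundary, Sum.elim_inl, Sum.inl.injEq, reduceCtorEq, or_false]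
    refine ⟨fun h => ?_, fun h => h ▸ l.2.1⟩
    by_contra hk
    exact l.2.2 k hk h
  · simp only [boundary, Sum.elim_inr, Sum.inr.injEq, reduceCtorEq, false_or]
    refine ⟨fun h => ?_, fun h => h ▸ m.2.1⟩
    by_contra hk
    exact m.2.2 k hk h

theorem boundary_noCirc {l m : Coset .D n} (v : Vertex n) :
    (boundary l.1 m.1).mark v ≠ .circ := by
  rcases v with k | k
  · exact l.2.1 k
  · exact m.2.1 k

theorem ODT.valid (x : ODT ty n) : x.diag.Valid ty (boundary x.top.1 x.bot.1) ∅ where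
  inv := x.isTangle.pair_pair
  dead_iff v := by simp [x.isTangle.pair_ne v]
  nc := x.isTangle.nonCrossing
  bead_pair := x.isTangle.bead_pair
  bead_dead v hv := by simp at hv
  exposed := x.isTangle.exposed
  oriented v _ := x.oriented v
  flip := x.flipOriented
  noCirc h := by subst h; exact boundary_noCirc
  circ h v _ hv := by
    subst h
    refine ⟨fun hb hc => ?_, fun hc => ?_⟩
    · rw [x.noBead rfl v hv hc] at hb; cases hb
    · rw [boundary_circ] at hv
      have h3 := x.inDT
      have inv := x.isTangle.pair_pair
      rw [Ne, boundary_circ, not_or] at hc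
      rcases hv with rfl | rfl
      · rcases h3 with h3 | h3 | h3
        · exact absurd h3.1 hc.2
        · exact absurd h3.1 hc.2
        · exact h3.2.1
      · have : x.diag.pair (inl 0) ≠ inr 0 := fun e => hc.1 (by rw [← e, inv])
        rcases h3 with h3 | h3 | h3
        · exact absurd h3.1 this
        · exact absurd h3.1 this
        · exact h3.2.2

theorem sum_strands {M : Type} [AddCommMonoid M] {d : Config (Vertex n)} (inv : ∀ v, d.pair (d.pair v) = v)
    (ne : ∀ v, d.pair v ≠ v) (g : Vertex n → M) :
    ∑ v, g v = ∑ v ∈ Finset.univ.filter (fun v => vertexPos v < vertexPos (d.pair v)),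
      (g v + g (d.pair v)) := by
  rw [Finset.sum_add_distrib,
    ← Finset.sum_filter_add_sum_filter_not _ (fun v => vertexPos v < vertexPos (d.pair v))]
  congr 1
  refine Finset.sum_nbij' d.pair d.pair ?_ ?_ ?_ ?_ ?_
  · intro v hv
    have h1 : vertexPos (d.pair v) ≠ vertexPos v := fun e => ne v (vertexPos_injective e)
    simp only [Finset.mem_filter, Finset.mem_univ, true_and, inv] at hv ⊢
    omega
  · intro v hv
    simp only [Finset.mem_filter, Finset.mem_univ, true_and, inv] at hv ⊢
    omega
  · intro v _; exact inv v
  · intro v _; exact inv v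
  · intro v _; rw [inv]

theorem even_decorated {l m : Coset .D n} {d : Config (Vertex n)}
    (h : d.Valid .D (boundary l.1 m.1) ∅) : InDT .D d := by
  classical
  have ne : ∀ v, d.pair v ≠ v := fun v e => by simpa using (h.dead_iff v).1 e
  have s1 := sum_strands h.inv ne (fun v =>
    if (boundary l.1 m.1).Inward v then (1 : ZMod 2) else 0)
  have s2 := sum_strands h.inv ne (fun _ => 1)
  have hl := ZMod.natCast_eq_zero_iff_even.2 l.2.2
  have hm := ZMod.natCast_eq_zero_iff_even.2 m.2.2
  simp only [Finset.sum_const, Finset.card_univ, Fintype.card_sum, Fintype.card_fin,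
    smul_eq_mul] at s2
  simp only [InDT]
  rw [← ZMod.natCast_eq_zero_iff_even, ← Finset.filter_filter, Finset.filter_comm,
    Finset.natCast_card_filter]
  set P := Finset.univ.filter (fun v => vertexPos v < vertexPos (d.pair v)) with hP
  have hcard : P.card = n + 1 := by omega
  have key : ∀ v, (if d.bead v = true then (1 : ZMod 2) else 0) =
      ((if (boundary l.1 m.1).Inward v then (1 : ZMod 2) else 0) +
        (if (boundary l.1 m.1).Inward (d.pair v) then (1 : ZMod 2) else 0)) + 1 := by
    intro v
    have n1 := h.noCirc rfl v
    have n2 := h.noCirc rfl (d.pair v)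
    have o := h.oriented v (by simp)
    have f := h.flip rfl v
    simp only [Frame.Oriented, Frame.FlipOriented, n1, n2, false_or] at o f
    by_cases hb : d.bead v = true
    · have f := f hb
      by_cases hi : (boundary l.1 m.1).Inward v
      · simp [hb, hi, f.1 hi]; decide
      · simp [hb, hi, mt f.2 hi]
    · have o := o (by simpa using hb)
      by_cases hi : (boundary l.1 m.1).Inward v
      · simp [hb, hi, o.1 hi]; decide
      · simp [hb, hi, not_not.1 (mt o.2 hi)]; decide
  rw [Finset.sum_congr rfl (fun v _ => key v), Finset.sum_add_distrib, ← s1]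
  rw [Fintype.sum_sum_type]
  have k1 : ∀ k, (if (boundary l.1 m.1).Inward (inl k) then (1 : ZMod 2) else 0) =
      1 + (if l.1 k = .wedge then 1 else 0) := by
    intro k
    have := l.2.1 k
    simp only [Frame.Inward, boundary, Sum.elim_inl, Sum.isRight_inl]
    cases hk : l.1 k <;> simp_all
    decide
  have k2 : ∀ k, (if (boundary l.1 m.1).Inward (inr k) then (1 : ZMod 2) else 0) =
      (if m.1 k = .wedge then 1 else 0) := by
    intro k
    simp [Frame.Inward, boundary]
  rw [Finset.sum_congr rfl (fun v _ => k1 v), Finset.sum_congr rfl (fun v _ => k2 v),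
    Finset.sum_add_distrib, ← Finset.natCast_card_filter, ← Finset.natCast_card_filter, hl, hm]
  simp only [Finset.sum_const, hcard, Finset.card_univ, Fintype.card_fin, add_zero]
  rw [← two_nsmul, smul_smul, mul_comm, mul_smul]
  have : (2 : ℕ) • (1 : ZMod 2) = 0 := by decide
  rw [this, smul_zero]

/-- A valid system of strands on the boundary of the frame is an oriented tangle. -/
def ODT.ofValid (l m : Coset ty n) (d : Config (Vertex n))
    (h : d.Valid ty (boundary l.1 m.1) ∅) : ODT ty n where
  top := l
  bot := m
  diag := d
  isTangle :=
    { pair_pair := h.inv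
      pair_ne := fun v e => by simpa using (h.dead_iff v).1 e
      nonCrossing := h.nc
      bead_pair := h.bead_pair
      exposed := h.exposed }
  inDT := by
    cases ty with
    | C =>
      have c0 := h.circ rfl (inl 0) (by simp) (boundary_circ.2 (.inl rfl))
      have c1 := h.circ rfl (inr 0) (by simp) (boundary_circ.2 (.inr rfl))
      rw [Ne, boundary_circ] at c0 c1
      have ne : ∀ v, d.pair v ≠ v := fun v e => by simpa using (h.dead_iff v).1 e
      by_cases h0 : d.pair (inl 0) = inr 0
      · left
        refine ⟨h0, ?_⟩
        simpa [h0] using c0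
      · right; right
        have h1 : d.pair (inr 0) ≠ inl 0 := fun e => h0 (by rw [← e, h.inv])
        exact ⟨h0, by simp [c0, ne, h0], by simp [c1, ne, h1]⟩
    | D => exact even_decorated h
  oriented v := h.oriented v (by simp)
  flipOriented := h.flip
  noBead hC v h1 h2 := by
    have := h.circ hC v (by simp) h1
    simpa [h2] using this

/-! Stacks of tangles. -/

/-- The tangles `D 0, D 1, …`, stacked from top to bottom. -/
def stack {m : ℕ} (D : Fin m → Config (Vertex n)) : Config (Fin m × Vertex n) where
  pair x := (x.1, (D x.1).pair x.2)
  bead x := (D x.1).bead x.2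

/-- The points of the stacked frames. The positions are those in the traversal of the boundaries of the
frames one after the other, each from its left-hand side. -/
def stackFrame {m : ℕ} (L : Fin m → Frame (Vertex n)) : Frame (Fin m × Vertex n) where
  pos x := x.1 * (2 * (n + 1)) + vertexPos x.2
  south x := x.2.isRight
  mark x := (L x.1).mark x.2

/-- The pairs of points that are glued when the tangle number `j` lies below the tangle number `i`, from left
to right: the `k`-th southern vertex of the upper one and the `k`-th northern vertex of the lower one. -/
def seam (n : ℕ) {m : ℕ} (i j : Fin m) : List ((Fin m × Vertex n) × (Fin m × Vertex n)) :=
  (List.finRange (n + 1)).map fun k => ((i, inr k), (j, inl k))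

/-- The vertices of the concatenation of two tangles. -/
def outer : Vertex n → Fin 2 × Vertex n
  | .inl k => (0, inl k)
  | .inr k => (1, inr k)

namespace ODT

/-- The labelled frame of an oriented tangle. -/
def frame (x : ODT ty n) : Frame (Vertex n) := boundary x.top.1 x.bot.1

/-- Place `x` above `y` and glue the southern vertices of `x` to the northern vertices of `y`. -/
def glued (x y : ODT ty n) : Config (Fin 2 × Vertex n) :=
  (stack ![x.diag, y.diag]).joinAll ty (stackFrame ![x.frame, y.frame]) (seam n 0 1)

/-- The exponent of the power of `q` that replaces the closed loops in the concatenation. -/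
def loops (x y : ODT ty n) : ℤ :=
  (stack ![x.diag, y.diag]).loopTotal ty (stackFrame ![x.frame, y.frame]) (seam n 0 1)

/-- The vertical concatenation of `x` and `y`, with `x` above `y`, all closed loops being removed. -/
def concat (x y : ODT ty n) : Config (Vertex n) where
  pair v := ((glued x y).pair (outer v)).2
  bead v := (glued x y).bead (outer v)

end ODT

theorem stack_lt {m : ℕ} (L : Fin m → Frame (Vertex n)) (x y : Fin m × Vertex n) :
    (stackFrame L).pos x < (stackFrame L).pos y ↔
      x.1 < y.1 ∨ (x.1 = y.1 ∧ vertexPos x.2 < vertexPos y.2) := by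
  obtain ⟨i, u⟩ := x
  obtain ⟨j, v⟩ := y
  have hu := vertexPos_lt u
  have hv := vertexPos_lt v
  simp only [stackFrame]
  rcases lt_trichotomy i j with h | h | h
  · have : (i.val + 1) * (2 * (n + 1)) ≤ j.val * (2 * (n + 1)) := Nat.mul_le_mul_right _ h
    rw [add_mul] at this
    simp only [h, true_or, iff_true]
    omega
  · subst h; simp
  · have : (j.val + 1) * (2 * (n + 1)) ≤ i.val * (2 * (n + 1)) := Nat.mul_le_mul_right _ h
    rw [add_mul] at this
    simp only [h.not_gt, h.ne', false_and, or_false, iff_false]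
    omega

theorem stack_injective {m : ℕ} (L : Fin m → Frame (Vertex n)) :
    Function.Injective (stackFrame L).pos := by
  intro x y h
  have h1 := (stack_lt L x y).not.1 (by omega)
  have h2 := (stack_lt L y x).not.1 (by omega)
  simp only [not_or, not_and, not_lt] at h1 h2
  have e : x.1 = y.1 := le_antisymm h2.1 h1.1
  exact Prod.ext e (vertexPos_injective (le_antisymm (h2.2 e.symm) (h1.2 e)))

theorem stack_valid {m : ℕ} {L : Fin m → Frame (Vertex n)} {D : Fin m → Config (Vertex n)}
    (hpos : ∀ i, (L i).pos = vertexPos) (hsouth : ∀ i, (L i).south = Sum.isRight)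
    (h : ∀ i, (D i).Valid ty (L i) ∅) : (stack D).Valid ty (stackFrame L) ∅ where
  inv x := by simp [stack, (h x.1).inv]
  dead_iff x := by
    have := (h x.1).dead_iff x.2
    simp only [Set.mem_empty_iff_false, iff_false] at this ⊢
    exact fun e => this (congrArg Prod.snd e)
  nc := by
    rintro ⟨i, u⟩ ⟨j, v⟩ h1 h2
    rw [stack_lt] at h1 h2 ⊢
    rw [stack_lt]
    simp only [stack] at h1 h2 ⊢
    have e : i = j := by
      rcases h1 with h1 | h1 <;> rcases h2 with h2 | h2 <;> grind
    subst e
    have := (h i).nc u v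
    rw [hpos] at this
    simp only [lt_self_iff_false, false_or, true_and] at h1 h2 ⊢
    exact this h1 h2
  bead_pair x := by simp [stack, (h x.1).bead_pair]
  bead_dead x hx := by simp at hx
  exposed := by
    rintro ⟨i, u⟩ hb ⟨j, v⟩ ⟨h1, h2, h3, h4⟩
    rw [stack_lt] at h1 h2 h3 h4
    simp only [stack] at h1 h2 h3 h4 hb
    have e : i = j := by
      rcases h1 with h1 | h1 <;> rcases h3 with h3 | h3 <;> grind
    subst e
    have := (h i).exposed u hb v
    rw [hpos] at this
    simp only [lt_self_iff_false, false_or, true_and] at h1 h2 h3 h4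
    exact this ⟨h1, h2, h3, h4⟩
  oriented := by
    rintro ⟨i, u⟩ _ hb
    have := (h i).oriented u (by simp) hb
    simp only [Frame.Oriented, Frame.Inward, hsouth] at this
    exact this
  flip := by
    rintro hD ⟨i, u⟩ hb
    have := (h i).flip hD u hb
    simp only [Frame.FlipOriented, Frame.Inward, hsouth] at this
    exact this
  noCirc hD x := (h x.1).noCirc hD x.2
  circ := by
    rintro hC ⟨i, u⟩ _ hm
    exact (h i).circ hC u (by simp) hm

theorem seam_nested {m : ℕ} (L : Fin m → Frame (Vertex n)) {i j : Fin m}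
    (hij : i.val + 1 = j.val)
    (hm : ∀ k, (L i).mark (inr k) = (L j).mark (inl k)) (l : List (Fin (n + 1))) :
    ∀ dead : Set (Fin m × Vertex n), l.Pairwise (· < ·) →
      (∀ k, k ∈ l ∨ ((i, inr k) ∈ dead ∧ (j, inl k) ∈ dead)) →
      (∀ k ∈ l, ((i, inr k) ∉ dead ∧ (j, inl k) ∉ dead)) →
      Nested (stackFrame L) dead
        (l.map fun k => (((i, inr k), (j, inl k)) : (Fin m × Vertex n) × (Fin m × Vertex n))) := by
  have hlt : i < j := by rw [Fin.lt_def]; omega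
  induction l with
  | nil => intro _ _ _ _; trivial
  | cons k l ih =>
    intro dead hs hc hd
    rw [List.pairwise_cons] at hs
    have hk := hd k (by simp)
    refine ⟨⟨?_, hk.1, hk.2, ?_, rfl, rfl, hm k⟩, ih _ hs.2 ?_ ?_⟩
    · rw [stack_lt]; exact .inl hlt
    · rintro ⟨p, v⟩ h1 h2
      rw [stack_lt] at h1 h2
      simp only at h1 h2
      have hp : p = i ∨ p = j := by
        rw [Fin.ext_iff, Fin.ext_iff]
        simp only [Fin.lt_def, Fin.ext_iff] at h1 h2
        omega
      have := k.2
      rcases hp with rfl | rfl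
      · simp only [lt_self_iff_false, false_or, true_and] at h1
        rcases v with q | q
        · simp [vertexPos] at h1; omega
        · have hq : q < k := by simp [vertexPos] at h1; omega
          rcases hc q with h | h
          · rcases List.mem_cons.1 h with rfl | h
            · exact absurd hq (lt_irrefl _)
            · exact absurd hq (hs.1 q h).not_gt
          · exact h.1
      · simp only [lt_self_iff_false, false_or, true_and] at h2
        rcases v with q | q
        · have hq : q < k := by simp [vertexPos] at h2; omega
          rcases hc q with h | h
          · rcases List.mem_cons.1 h with rfl | h
            · exact absurd hq (lt_irrefl _)
            · exact absurd hq (hs.1 q h).not_gt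
          · exact h.2
        · simp [vertexPos] at h2; omega
    · intro q
      rcases hc q with h | h
      · rcases List.mem_cons.1 h with rfl | h
        · right; simp
        · exact .inl h
      · right; simp [h.1, h.2]
    · intro q hq
      have h1 := hs.1 q hq
      have h2 := hd q (by simp [hq])
      simp [h2.1, h2.2, h1.ne']

theorem seam_nested_empty {m : ℕ} (L : Fin m → Frame (Vertex n)) {i j : Fin m}
    (hij : i.val + 1 = j.val) (hm : ∀ k, (L i).mark (inr k) = (L j).mark (inl k)) :
    Nested (stackFrame L) ∅ (seam n i j) :=
  seam_nested L hij hm _ ∅ (List.pairwise_lt_finRange _) (fun k => .inl (List.mem_finRange k))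
    (by simp)

theorem mem_seam {m : ℕ} {i j : Fin m} {p : (Fin m × Vertex n) × (Fin m × Vertex n)} :
    p ∈ seam n i j ↔ ∃ k, p = ((i, inr k), (j, inl k)) := by
  simp [seam, eq_comm]

theorem Config.Valid.of_tracks {α β : Type} {f : α → β} {F : Frame α} {G : Frame β}
    {S : Config α} {S' : Config β} {dead : Set β} (h : S'.Valid ty G dead) (t : Tracks f S S')
    (hf : Function.Injective f) (hpos : ∀ x y, G.pos (f x) < G.pos (f y) ↔ F.pos x < F.pos y)
    (hmark : ∀ x, G.mark (f x) = F.mark x) (hsouth : ∀ x, G.south (f x) = F.south x)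
    (hd : ∀ x, f x ∉ dead) : S.Valid ty F ∅ where
  inv x := hf (by rw [← (t _).1, ← (t x).1, h.inv])
  dead_iff x := by
    have := h.dead_iff (f x)
    rw [(t x).1, hf.eq_iff] at this
    simpa [hd x] using this
  nc x y h1 h2 := by
    have := h.nc (f x) (f y)
    rw [(t x).1, (t y).1] at this
    simp only [hpos] at this
    exact this h1 h2
  bead_pair x := by rw [← (t _).2, ← (t x).1, h.bead_pair, (t x).2]
  bead_dead x hx := by simp at hx
  exposed x hb y := by
    have := h.exposed (f x) (by rw [(t x).2, hb]) (f y)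
    rw [(t x).1, (t y).1] at this
    simpa only [hpos] using this
  oriented x _ hb := by
    have := h.oriented (f x) (hd x) (by rw [(t x).2, hb])
    rw [(t x).1] at this
    simpa only [Frame.Oriented, Frame.Inward, hmark, hsouth] using this
  flip hD x hb := by
    have := h.flip hD (f x) (by rw [(t x).2, hb])
    rw [(t x).1] at this
    simpa only [Frame.FlipOriented, Frame.Inward, hmark, hsouth] using this
  noCirc hD x := by rw [← hmark]; exact h.noCirc hD _
  circ hC x _ hm := by
    have := h.circ hC (f x) (hd x) (by rw [hmark, hm])
    rwa [(t x).1, (t x).2, hmark] at this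

theorem outer_injective : Function.Injective (outer (n := n)) := by
  rintro (a | a) (b | b) h <;> simp_all [outer]

namespace ODT

theorem glued_valid (x y : ODT ty n) (h : x.bot = y.top) :
    (glued x y).Valid ty (stackFrame ![x.frame, y.frame])
      (deadAfter ∅ (seam n (0 : Fin 2) 1)) := by
  refine Valid.joinAll (stack_injective _) _ (stack_valid ?_ ?_ ?_)
    (seam_nested_empty _ rfl ?_)
  · intro i; fin_cases i <;> rfl
  · intro i; fin_cases i <;> rfl
  · intro i; fin_cases i
    · exact x.valid
    · exact y.valid
  · intro k; simp [frame, boundary, h]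

theorem outer_not_dead (v : Vertex n) : outer v ∉ deadAfter ∅ (seam n (0 : Fin 2) 1) := by
  rw [mem_deadAfter]
  rintro (h | ⟨p, hp, h⟩)
  · exact h
  · obtain ⟨k, rfl⟩ := mem_seam.1 hp
    rcases v with v | v <;> simp [outer] at h

theorem not_dead {p : Fin 2 × Vertex n} (h : p ∉ deadAfter ∅ (seam n (0 : Fin 2) 1)) :
    p = outer p.2 := by
  rw [mem_deadAfter] at h
  obtain ⟨i, v⟩ := p
  push Not at h
  fin_cases i <;> rcases v with k | k
  · rfl
  · exact absurd rfl (h.2 _ (mem_seam.2 ⟨k, rfl⟩)).1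
  · exact absurd rfl (h.2 _ (mem_seam.2 ⟨k, rfl⟩)).2
  · rfl

theorem concat_tracks (x y : ODT ty n) (h : x.bot = y.top) :
    Tracks outer (concat x y) (glued x y) := fun v =>
  ⟨not_dead ((glued_valid x y h).not_dead_pair (outer_not_dead v)), rfl⟩

theorem concat_valid (x y : ODT ty n) (h : x.bot = y.top) :
    (concat x y).Valid ty (boundary x.top.1 y.bot.1) ∅ := by
  refine (glued_valid x y h).of_tracks (concat_tracks x y h) outer_injective ?_ ?_ ?_
    outer_not_dead
  · rintro (⟨a, ha⟩ | ⟨a, ha⟩) (⟨b, hb⟩ | ⟨b, hb⟩) <;> rw [stack_lt] <;>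
      simp [outer, boundary, vertexPos] <;> omega
  · rintro (a | a) <;> rfl
  · rintro (a | a) <;> rfl

/-- The vertical concatenation as an oriented tangle. -/
def comp (x y : ODT ty n) (h : x.bot = y.top) : ODT ty n :=
  ofValid x.top y.bot (concat x y) (concat_valid x y h)

/-- An auxiliary embedding for the proof of associativity. -/
def left3 : Fin 2 × Vertex n → Fin 3 × Vertex n
  | (0, .inl k) => (0, inl k)
  | (0, .inr k) => (1, inr k)
  | (1, v) => (2, v)

/-- An auxiliary embedding for the proof of associativity. -/
def right3 : Fin 2 × Vertex n → Fin 3 × Vertex n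
  | (0, v) => (0, v)
  | (1, .inl k) => (1, inl k)
  | (1, .inr k) => (2, inr k)

theorem left3_injective : Function.Injective (left3 (n := n)) := by
  rintro ⟨i, a | a⟩ ⟨j, b | b⟩ h <;> fin_cases i <;> fin_cases j <;> simp_all [left3]

theorem right3_injective : Function.Injective (right3 (n := n)) := by
  rintro ⟨i, a | a⟩ ⟨j, b | b⟩ h <;> fin_cases i <;> fin_cases j <;> simp_all [right3]

theorem comp_left (x y z : ODT ty n) (h : x.bot = y.top) :
    Tracks left3 (glued (comp x y h) z)
      (((stack ![x.diag, y.diag, z.diag]).joinAll ty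
        (stackFrame ![x.frame, y.frame, z.frame]) (seam n 0 1)).joinAll ty
        (stackFrame ![x.frame, y.frame, z.frame]) (seam n 1 2)) ∧
    loops x y + loops (comp x y h) z =
      (stack ![x.diag, y.diag, z.diag]).loopTotal ty
        (stackFrame ![x.frame, y.frame, z.frame]) (seam n 0 1) +
      ((stack ![x.diag, y.diag, z.diag]).joinAll ty
        (stackFrame ![x.frame, y.frame, z.frame]) (seam n 0 1)).loopTotal ty
        (stackFrame ![x.frame, y.frame, z.frame]) (seam n 1 2) := by
  have t1 : Tracks (Prod.map Fin.castSucc id) (stack ![x.diag, y.diag])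
      (stack ![x.diag, y.diag, z.diag]) := by
    rintro ⟨i, v⟩; fin_cases i <;> exact ⟨rfl, rfl⟩
  have j1 := t1.joinAll (ty := ty) (F := stackFrame ![x.frame, y.frame])
    (G := stackFrame ![x.frame, y.frame, z.frame])
    ((Fin.castSucc_injective 2).prodMap Function.injective_id)
    (by rintro ⟨i, v⟩; fin_cases i <;> rfl) (seam n 0 1)
  have e1 : (seam n (0 : Fin 2) 1).map (Prod.map (Prod.map Fin.castSucc id)
      (Prod.map Fin.castSucc id)) = seam n (0 : Fin 3) 1 := by
    simp only [seam, List.map_map]; rfl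
  rw [e1] at j1
  have t2 : Tracks (fun v => ((2 : Fin 3), v)) z.diag
      ((stack ![x.diag, y.diag, z.diag]).joinAll ty
        (stackFrame ![x.frame, y.frame, z.frame]) (seam n 0 1)) := by
    refine Tracks.joinAll_out _ ?_ (fun v => ⟨rfl, rfl⟩)
    intro p hp v
    obtain ⟨k, rfl⟩ := mem_seam.1 hp
    simp
  have t3 : Tracks left3 (stack ![(comp x y h).diag, z.diag])
      ((stack ![x.diag, y.diag, z.diag]).joinAll ty
        (stackFrame ![x.frame, y.frame, z.frame]) (seam n 0 1)) := by
    have c := concat_tracks x y h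
    have l0 : ∀ w : Vertex n, left3 (0, w) = Prod.map Fin.castSucc id (outer w) := by
      rintro (w | w) <;> rfl
    rintro ⟨i, v⟩
    fin_cases i
    · have a1 := j1.1 (outer v)
      have a2 := c v
      change _ = left3 (0, (concat x y).pair v) ∧ _ = (concat x y).bead v
      change ((stack ![x.diag, y.diag, z.diag]).joinAll ty
        (stackFrame ![x.frame, y.frame, z.frame]) (seam n 0 1)).pair (left3 (0, v)) = _ ∧
        ((stack ![x.diag, y.diag, z.diag]).joinAll ty
        (stackFrame ![x.frame, y.frame, z.frame]) (seam n 0 1)).bead (left3 (0, v)) = _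
      rw [l0, l0, ← a2.1]
      exact ⟨a1.1, a1.2⟩
    · exact t2 v
  have j2 := t3.joinAll (ty := ty) (F := stackFrame ![(comp x y h).frame, z.frame])
    (G := stackFrame ![x.frame, y.frame, z.frame]) left3_injective
    (by
      rintro ⟨i, v | v⟩ <;> fin_cases i <;> rfl) (seam n 0 1)
  have e2 : (seam n (0 : Fin 2) 1).map (Prod.map left3 left3) = seam n (1 : Fin 3) 2 := by
    simp only [seam, List.map_map]; rfl
  rw [e2] at j2
  exact ⟨j2.1, by rw [j1.2, j2.2]; rfl⟩

theorem comp_right (x y z : ODT ty n) (h : y.bot = z.top) :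
    Tracks right3 (glued x (comp y z h))
      (((stack ![x.diag, y.diag, z.diag]).joinAll ty
        (stackFrame ![x.frame, y.frame, z.frame]) (seam n 1 2)).joinAll ty
        (stackFrame ![x.frame, y.frame, z.frame]) (seam n 0 1)) ∧
    loops y z + loops x (comp y z h) =
      (stack ![x.diag, y.diag, z.diag]).loopTotal ty
        (stackFrame ![x.frame, y.frame, z.frame]) (seam n 1 2) +
      ((stack ![x.diag, y.diag, z.diag]).joinAll ty
        (stackFrame ![x.frame, y.frame, z.frame]) (seam n 1 2)).loopTotal ty
        (stackFrame ![x.frame, y.frame, z.frame]) (seam n 0 1) := by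
  have t1 : Tracks (Prod.map Fin.succ id) (stack ![y.diag, z.diag])
      (stack ![x.diag, y.diag, z.diag]) := by
    rintro ⟨i, v⟩; fin_cases i <;> exact ⟨rfl, rfl⟩
  have j1 := t1.joinAll (ty := ty) (F := stackFrame ![y.frame, z.frame])
    (G := stackFrame ![x.frame, y.frame, z.frame])
    ((Fin.succ_injective 2).prodMap Function.injective_id)
    (by rintro ⟨i, v⟩; fin_cases i <;> rfl) (seam n 0 1)
  have e1 : (seam n (0 : Fin 2) 1).map (Prod.map (Prod.map Fin.succ id)
      (Prod.map Fin.succ id)) = seam n (1 : Fin 3) 2 := by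
    simp only [seam, List.map_map]; rfl
  rw [e1] at j1
  have t2 : Tracks (fun v => ((0 : Fin 3), v)) x.diag
      ((stack ![x.diag, y.diag, z.diag]).joinAll ty
        (stackFrame ![x.frame, y.frame, z.frame]) (seam n 1 2)) := by
    refine Tracks.joinAll_out _ ?_ (fun v => ⟨rfl, rfl⟩)
    intro p hp v
    obtain ⟨k, rfl⟩ := mem_seam.1 hp
    simp
  have t3 : Tracks right3 (stack ![x.diag, (comp y z h).diag])
      ((stack ![x.diag, y.diag, z.diag]).joinAll ty
        (stackFrame ![x.frame, y.frame, z.frame]) (seam n 1 2)) := by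
    have c := concat_tracks y z h
    have l0 : ∀ w : Vertex n, right3 (1, w) = Prod.map Fin.succ id (outer w) := by
      rintro (w | w) <;> rfl
    rintro ⟨i, v⟩
    fin_cases i
    · exact t2 v
    · have a1 := j1.1 (outer v)
      have a2 := c v
      change ((stack ![x.diag, y.diag, z.diag]).joinAll ty
        (stackFrame ![x.frame, y.frame, z.frame]) (seam n 1 2)).pair (right3 (1, v)) =
          right3 (1, (concat y z).pair v) ∧
        ((stack ![x.diag, y.diag, z.diag]).joinAll ty
        (stackFrame ![x.frame, y.frame, z.frame]) (seam n 1 2)).bead (right3 (1, v)) =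
          (concat y z).bead v
      rw [l0, l0, ← a2.1]
      exact ⟨a1.1, a1.2⟩
  have j2 := t3.joinAll (ty := ty) (F := stackFrame ![x.frame, (comp y z h).frame])
    (G := stackFrame ![x.frame, y.frame, z.frame]) right3_injective
    (by
      rintro ⟨i, v | v⟩ <;> fin_cases i <;> rfl) (seam n 0 1)
  have e2 : (seam n (0 : Fin 2) 1).map (Prod.map right3 right3) = seam n (0 : Fin 3) 1 := by
    simp only [seam, List.map_map]; rfl
  rw [e2] at j2
  exact ⟨j2.1, by rw [j1.2, j2.2]; rfl⟩

theorem joins_comm (x y z : ODT ty n) (h : x.bot = y.top) (h' : y.bot = z.top) :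
    ((stack ![x.diag, y.diag, z.diag]).joinAll ty
        (stackFrame ![x.frame, y.frame, z.frame]) (seam n 1 2)).joinAll ty
        (stackFrame ![x.frame, y.frame, z.frame]) (seam n 0 1) =
      ((stack ![x.diag, y.diag, z.diag]).joinAll ty
        (stackFrame ![x.frame, y.frame, z.frame]) (seam n 0 1)).joinAll ty
        (stackFrame ![x.frame, y.frame, z.frame]) (seam n 1 2) ∧
    (stack ![x.diag, y.diag, z.diag]).loopTotal ty
        (stackFrame ![x.frame, y.frame, z.frame]) (seam n 1 2) +
      ((stack ![x.diag, y.diag, z.diag]).joinAll ty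
        (stackFrame ![x.frame, y.frame, z.frame]) (seam n 1 2)).loopTotal ty
        (stackFrame ![x.frame, y.frame, z.frame]) (seam n 0 1) =
      (stack ![x.diag, y.diag, z.diag]).loopTotal ty
        (stackFrame ![x.frame, y.frame, z.frame]) (seam n 0 1) +
      ((stack ![x.diag, y.diag, z.diag]).joinAll ty
        (stackFrame ![x.frame, y.frame, z.frame]) (seam n 0 1)).loopTotal ty
        (stackFrame ![x.frame, y.frame, z.frame]) (seam n 1 2) := by
  refine joinAll_comm (stack_injective _) _ _ (dead := ∅) (stack_valid ?_ ?_ ?_)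
    (seam_nested_empty _ rfl ?_) (seam_nested_empty _ rfl ?_) ?_
  · intro i; fin_cases i <;> rfl
  · intro i; fin_cases i <;> rfl
  · intro i; fin_cases i
    · exact x.valid
    · exact y.valid
    · exact z.valid
  · intro k; simp [frame, boundary, h]
  · intro k; simp [frame, boundary, h']
  · intro p hp q hq
    obtain ⟨k, rfl⟩ := mem_seam.1 hp
    obtain ⟨j, rfl⟩ := mem_seam.1 hq
    rw [stack_lt]
    right
    refine ⟨rfl, ?_⟩
    have := k.2
    have := j.2
    simp [vertexPos]; omega

theorem comp_assoc (x y z : ODT ty n) (h : x.bot = y.top) (h' : y.bot = z.top) :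
    comp (comp x y h) z h' = comp x (comp y z h') h ∧
    loops x y + loops (comp x y h) z = loops y z + loops x (comp y z h') := by
  have l := comp_left x y z h
  have r := comp_right x y z h'
  have c := joins_comm x y z h h'
  have o : ∀ v : Vertex n, left3 (outer v) = right3 (outer v) := by rintro (v | v) <;> rfl
  have t1 : ∀ v, _ := concat_tracks (comp x y h) z h'
  have t2 : ∀ v, _ := concat_tracks x (comp y z h') h
  rw [c.1] at r
  refine ⟨?_, by rw [l.2, r.2, c.2]⟩
  apply ODT.ext
  · rfl
  · rfl
  · change concat (comp x y h) z = concat x (comp y z h')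
    ext v
    · apply outer_injective
      apply right3_injective
      rw [← o, ← (t1 v).1, ← (t2 v).1, ← (l.1 _).1, ← (r.1 _).1, o]
    · rw [← (t1 v).2, ← (t2 v).2, ← (l.1 _).2, ← (r.1 _).2, o]

/-! Identity tangles. -/

/-- The identity tangle: vertical strands without beads. -/
def idConfig (n : ℕ) : Config (Vertex n) where
  pair := Sum.swap
  bead _ := false

theorem idConfig_valid (l : Coset ty n) : (idConfig n).Valid ty (boundary l.1 l.1) ∅ where
  inv := Sum.swap_swap
  dead_iff v := by rcases v with v | v <;> simp [idConfig]
  nc := by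
    rintro (⟨a, ha⟩ | ⟨a, ha⟩) (⟨b, hb⟩ | ⟨b, hb⟩) <;> simp [idConfig, boundary, vertexPos] <;> omega
  bead_pair _ := rfl
  bead_dead v hv := by simp at hv
  exposed v hv := by simp [idConfig] at hv
  oriented v _ _ := by
    rcases v with v | v <;> cases h : l.1 v <;>
      simp [idConfig, boundary, Frame.Oriented, Frame.Inward, h]
  flip _ v hv := by simp [idConfig] at hv
  noCirc h := by subst h; exact boundary_noCirc
  circ hC v _ hv := by
    rcases v with v | v <;> simp_all [idConfig, boundary]

/-- The oriented tangle `λ 1 λ`. -/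
def one (l : Coset ty n) : ODT ty n := ofValid l l (idConfig n) (idConfig_valid l)

theorem fuse_false {α : Type} {F : Frame α} {a b : α} {c : Bool}
    (hD : ty = .D → F.mark a ≠ .circ)
    (h : ty = .C → F.mark a = .circ → F.mark b = .circ → c = false) :
    fuse ty F a b false c = c := by
  cases ty <;> simp only [fuse, Bool.false_or, Bool.false_xor] <;> split_ifs with h1
  · exact (h rfl h1.1 h1.2).symm
  · rfl
  · exact absurd h1.1 (hD rfl)
  · rfl

theorem absorb_step {α V : Type} [DecidableEq α] [DecidableEq V] {F : Frame α} {X : Config V}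
    {S : Config α} {g : V → α} {v : V} {i j e : α}
    (inv : ∀ w, X.pair (X.pair w) = w) (ne : ∀ w, X.pair w ≠ w)
    (bp : ∀ w, X.bead (X.pair w) = X.bead w)
    (t : Tracks g X S) (hg : Function.Injective g) (hj : g v = j)
    (hi : S.pair i = e) (he : S.pair e = i) (bi : S.bead i = false)
    (hie : i ≠ e) (gi : ∀ w, g w ≠ i) (ge : ∀ w, g w ≠ e)
    (hD : ty = .D → F.mark e ≠ .circ)
    (hC : ty = .C → F.mark e = .circ → F.mark (g (X.pair v)) = .circ → X.bead v = false) :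
    Tracks (Function.update g v e) X (S.join ty F i j) := by
  subst hj
  have tv := t v
  have fz : fuse ty F e (g (X.pair v)) false (X.bead v) = X.bead v := fuse_false hD hC
  intro w
  have tw := t w
  have ei := gi (X.pair w)
  have e1 := ge v
  have e2 := gi v
  by_cases hw : w = v
  · subst hw
    simp only [Function.update_self, join, he, hi, tv.1, tv.2, bi, fz,
      Function.update_of_ne (ne w)]
    simp [hie.symm, (ge w).symm]
  · have gw : g w ≠ g v := fun h => hw (hg h)
    rw [Function.update_of_ne hw]
    by_cases hpw : X.pair w = v
    · have hb : X.bead w = X.bead v := by rw [← hpw, bp]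
      simp only [join, tw.1, tw.2, tv.1, tv.2, hpw, hi, bi, fz, hb, Function.update_self]
      simp [gi w, gw, gi v]
    · have gpw : g (X.pair w) ≠ g v := fun h => hpw (hg h)
      simp only [join, tw.1, tw.2, Function.update_of_ne hpw]
      simp [gi w, gw, gi (X.pair w), gpw]

theorem absorb {α V κ : Type} [DecidableEq α] [DecidableEq V] {F : Frame α} {X : Config V}
    (inv : ∀ w, X.pair (X.pair w) = w) (ne : ∀ w, X.pair w ≠ w)
    (bp : ∀ w, X.bead (X.pair w) = X.bead w)
    (v : κ → V) (i j e : κ → α) (p : κ → α × α)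
    (hp : ∀ k, p k = (i k, j k) ∨ p k = (j k, i k))
    (hv : Function.Injective v) (hi : Function.Injective i) (he : Function.Injective e)
    (hie : ∀ k l, i k ≠ e l) (M : V → Mark) (hM : ∀ k, M (v k) = F.mark (e k))
    (hD : ty = .D → ∀ w, M w ≠ .circ)
    (hC : ty = .C → ∀ w, M w = .circ → M (X.pair w) = .circ → X.bead w = false)
    (l : List κ) : ∀ (g : V → α) (S : Config α), l.Nodup → Tracks g X S →
      Function.Injective g → (∀ w, F.mark (g w) = M w) → (∀ k ∈ l, g (v k) = j k) →
      (∀ k ∈ l, S.pair (i k) = e k ∧ S.pair (e k) = i k ∧ S.bead (i k) = false ∧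
        S.bead (e k) = false ∧ ∀ w, g w ≠ i k ∧ g w ≠ e k) →
      S.loopTotal ty F (l.map p) = 0 ∧
      ∃ g' : V → α, Tracks g' X (S.joinAll ty F (l.map p)) ∧ (∀ k ∈ l, g' (v k) = e k) ∧
        ∀ w, (∀ k ∈ l, w ≠ v k) → g' w = g w := by
  induction l with
  | nil => intro g S _ t _ _ _ _; exact ⟨rfl, g, t, by simp, by simp⟩
  | cons k l ih =>
    intro g S hn t hg hm hj hs
    rw [List.nodup_cons] at hn
    have hk := hs k (by simp)
    have hjk := hj k (by simp)
    have hij : i k ≠ j k := by rw [← hjk]; exact ((hk.2.2.2.2 _).1).symm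
    have hej : e k ≠ j k := by rw [← hjk]; exact ((hk.2.2.2.2 _).2).symm
    have hjoin : S.join ty F (p k).1 (p k).2 = S.join ty F (i k) (j k) := by
      rcases hp k with h | h <;> rw [h]
      exact join_symm hij.symm
    have hloop : loopDegree F S (p k).1 (p k).2 = 0 := by
      rcases hp k with h | h <;> rw [h] <;> simp only [loopDegree]
      · rw [hk.1, if_neg hej]
      · rw [if_neg]
        rw [← hjk, (t _).1]
        exact (hk.2.2.2.2 _).1
    have t' := absorb_step (ty := ty) (F := F) inv ne bp t hg hjk hk.1 hk.2.1 hk.2.2.1 (hie k k)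
      (fun w => (hk.2.2.2.2 w).1) (fun w => (hk.2.2.2.2 w).2)
      (fun h => by rw [← hM]; exact hD h _)
      (fun h h1 h2 => hC h _ (by rw [hM, h1]) (by rw [← hm, h2]))
    have kl : ∀ q ∈ l, q ≠ k := fun q hq h => hn.1 (h ▸ hq)
    have hg' : ∀ w, w ≠ v k → Function.update g (v k) (e k) w = g w :=
      fun w hw => Function.update_of_ne hw _ _
    obtain ⟨a, g', b, c, d⟩ := ih (Function.update g (v k) (e k)) (S.join ty F (i k) (j k)) hn.2 t'
      (by
        intro a b hab
        by_cases ha : a = v k <;> by_cases hb : b = v k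
        · rw [ha, hb]
        · subst ha; rw [Function.update_self, hg' b hb] at hab
          exact absurd hab.symm (hk.2.2.2.2 _).2
        · subst hb; rw [Function.update_self, hg' a ha] at hab
          exact absurd hab (hk.2.2.2.2 _).2
        · rw [hg' a ha, hg' b hb] at hab; exact hg hab)
      (by
        intro w
        by_cases hw : w = v k
        · subst hw; rw [Function.update_self, hM]
        · rw [hg' w hw, hm])
      (by
        intro q hq
        rw [hg' _ (fun h => kl q hq (hv h)), hj q (by simp [hq])])
      (by
        intro q hq
        have hsq := hs q (by simp [hq])
        have n1 : i q ≠ i k := fun h => kl q hq (hi h)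
        have n2 : e q ≠ e k := fun h => kl q hq (he h)
        have n3 := hie q k
        have n4 := hie k q
        have n5 : i q ≠ j k := by rw [← hjk]; exact ((hsq.2.2.2.2 _).1).symm
        have n6 : e q ≠ j k := by rw [← hjk]; exact ((hsq.2.2.2.2 _).2).symm
        refine ⟨?_, ?_, ?_, ?_, ?_⟩
        · simp [join, hsq.1, n1, n5, n4.symm, n6]
        · simp [join, hsq.2.1, n4.symm, n6, n1, n5]
        · simp [join, hsq.1, n1, n5, n4.symm, n6, hsq.2.2.1]
        · simp [join, hsq.2.1, n4.symm, n6, n1, n5, hsq.2.2.2.1]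
        · intro w
          by_cases hw : w = v k
          · subst hw; rw [Function.update_self]; exact ⟨n3.symm, n2.symm⟩
          · rw [hg' w hw]; exact hsq.2.2.2.2 w)
    simp only [List.map_cons, loopTotal, Config.joinAll, hjoin, hloop, a, zero_add, true_and]
    refine ⟨g', b, ?_, ?_⟩
    · intro q hq
      by_cases hql : q ∈ l
      · exact c q hql
      · have hqk : q = k := by
          rcases List.mem_cons.1 hq with h | h
          · exact h
          · exact absurd h hql
        subst hqk
        rw [d _ (fun r hr h => hql (by rw [hv h]; exact hr)), Function.update_self]
    · intro w hw
      rw [d w (fun r hr => hw r (by simp [hr])), hg' w (hw k (by simp))]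

theorem noCirc (x : ODT ty n) (h : ty = .D) (w : Vertex n) : x.frame.mark w ≠ .circ :=
  x.valid.noCirc h w

theorem one_comp' (l : Coset ty n) (x : ODT ty n) (h : l = x.top) :
    loops (one l) x = 0 ∧ concat (one l) x = x.diag := by
  subst h
  obtain ⟨a, g, b, c, d⟩ := absorb (ty := ty) (F := stackFrame ![(one x.top).frame, x.frame])
    (X := x.diag) (κ := Fin (n + 1))
    x.isTangle.pair_pair x.isTangle.pair_ne x.isTangle.bead_pair inl (fun k => ((0 : Fin 2), inr k))
    (fun k => (1, inl k)) (fun k => (0, inl k)) (fun k => ((0, inr k), (1, inl k)))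
    (fun k => .inl rfl) Sum.inl_injective (fun _ _ h => by simpa using h)
    (fun _ _ h => by simpa using h) (by simp) x.frame.mark (fun k => rfl)
    x.noCirc x.noBead (List.finRange (n + 1)) (fun w => (1, w))
    (stack ![(one x.top).diag, x.diag]) (List.nodup_finRange _)
    (fun w => ⟨rfl, rfl⟩) (fun _ _ h => by simpa using h) (fun w => rfl) (fun k _ => rfl)
    (fun k _ => ⟨rfl, rfl, rfl, rfl, by simp⟩)
  refine ⟨a, ?_⟩
  have hg : g = outer := by
    funext w
    rcases w with w | w
    · exact c w (List.mem_finRange w)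
    · exact d _ (by simp)
  subst hg
  ext w
  · exact outer_injective (((concat_tracks (one x.top) x rfl) w).1.symm.trans (b w).1)
  · exact (b w).2

theorem comp_one' (l : Coset ty n) (x : ODT ty n) (h : x.bot = l) :
    loops x (one l) = 0 ∧ concat x (one l) = x.diag := by
  subst h
  obtain ⟨a, g, b, c, d⟩ := absorb (ty := ty) (F := stackFrame ![x.frame, (one x.bot).frame])
    (X := x.diag) (κ := Fin (n + 1))
    x.isTangle.pair_pair x.isTangle.pair_ne x.isTangle.bead_pair inr (fun k => ((1 : Fin 2), inl k))
    (fun k => (0, inr k)) (fun k => (1, inr k)) (fun k => ((0, inr k), (1, inl k)))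
    (fun k => .inr rfl) Sum.inr_injective (fun _ _ h => by simpa using h)
    (fun _ _ h => by simpa using h) (by simp) x.frame.mark (fun k => rfl)
    x.noCirc x.noBead (List.finRange (n + 1)) (fun w => (0, w))
    (stack ![x.diag, (one x.bot).diag]) (List.nodup_finRange _)
    (fun w => ⟨rfl, rfl⟩) (fun _ _ h => by simpa using h) (fun w => rfl) (fun k _ => rfl)
    (fun k _ => ⟨rfl, rfl, rfl, rfl, by simp⟩)
  refine ⟨a, ?_⟩
  have hg : g = outer := by
    funext w
    rcases w with w | w
    · exact d _ (by simp)
    · exact c w (List.mem_finRange w)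
  subst hg
  ext w
  · exact outer_injective (((concat_tracks x (one x.bot) rfl) w).1.symm.trans (b w).1)
  · exact (b w).2

theorem one_comp (l : Coset ty n) (x : ODT ty n) (h : (one l).bot = x.top) :
    comp (one l) x h = x ∧ loops (one l) x = 0 :=
  ⟨ODT.ext h rfl (one_comp' l x h).2, (one_comp' l x h).1⟩

theorem comp_one (l : Coset ty n) (x : ODT ty n) (h : x.bot = (one l).top) :
    comp x (one l) h = x ∧ loops x (one l) = 0 :=
  ⟨ODT.ext rfl h.symm (comp_one' l x h).2, (comp_one' l x h).1⟩

end ODT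

/-- The oriented Temperley--Lieb algebra: the free `ℤ[q, q⁻¹]`-module on the oriented tangles. -/
def OTL (ty : PairType) (n : ℕ) : Type := ODT ty n →₀ LaurentPolynomial ℤ

namespace OTL

noncomputable instance : AddCommGroup (OTL ty n) :=
  inferInstanceAs (AddCommGroup (ODT ty n →₀ LaurentPolynomial ℤ))

noncomputable instance : Module (LaurentPolynomial ℤ) (OTL ty n) :=
  inferInstanceAs (Module (LaurentPolynomial ℤ) (ODT ty n →₀ LaurentPolynomial ℤ))

/-- The basis element of the oriented tangle `x`. -/
noncomputable def basis (x : ODT ty n) : OTL ty n := Finsupp.single x 1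

open Classical in
/-- The product of basis elements: `(λdμ)(λ'd'μ') = 0` if `μ ≠ λ'`, and otherwise the vertical concatenation
times the power of `q` by which the closed loops are replaced. -/
noncomputable def mulBasis (x y : ODT ty n) : OTL ty n :=
  if h : x.bot = y.top then
    (LaurentPolynomial.T (ODT.loops x y) : LaurentPolynomial ℤ) • basis (ODT.comp x y h)
  else 0

/-- The linear map with given values on the basis. -/
noncomputable def lift {M : Type} [AddCommGroup M] [Module (LaurentPolynomial ℤ) M]
    (f : ODT ty n → M) : OTL ty n →ₗ[LaurentPolynomial ℤ] M :=
  Finsupp.linearCombination (LaurentPolynomial ℤ) f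

theorem lift_basis {M : Type} [AddCommGroup M] [Module (LaurentPolynomial ℤ) M]
    (f : ODT ty n → M) (x : ODT ty n) : lift f (basis x) = f x :=
  (Finsupp.linearCombination_single (LaurentPolynomial ℤ) 1 x).trans (one_smul _ _)

theorem hom_ext {M : Type} [AddCommGroup M] [Module (LaurentPolynomial ℤ) M]
    {f g : OTL ty n →ₗ[LaurentPolynomial ℤ] M} (h : ∀ x, f (basis x) = g (basis x)) : f = g :=
  Finsupp.lhom_ext' fun x => LinearMap.ext_ring (h x)

/-- The bilinear extension of the product of basis elements. -/
noncomputable def mulMap : OTL ty n →ₗ[LaurentPolynomial ℤ] OTL ty n →ₗ[LaurentPolynomial ℤ]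
    OTL ty n :=
  lift fun x => lift fun y => mulBasis x y

theorem mulMap_basis (x y : ODT ty n) : mulMap (basis x) (basis y) = mulBasis x y := by
  rw [mulMap, lift_basis, lift_basis]

theorem mulMap_eq (x y : ODT ty n) (h : x.bot = y.top) : mulMap (basis x) (basis y) =
    (LaurentPolynomial.T (ODT.loops x y) : LaurentPolynomial ℤ) • basis (ODT.comp x y h) := by
  rw [mulMap_basis, mulBasis, dif_pos h]

theorem mulMap_ne (x y : ODT ty n) (h : x.bot ≠ y.top) : mulMap (basis x) (basis y) = 0 := by
  rw [mulMap_basis, mulBasis, dif_neg h]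

/-- The unit `∑ λ 1 λ`. -/
noncomputable def unit (ty : PairType) (n : ℕ) : OTL ty n := ∑ l : Coset ty n, basis (ODT.one l)

theorem mulMap_assoc (a b c : OTL ty n) : mulMap (mulMap a b) c = mulMap a (mulMap b c) := by
  have : (LinearMap.llcomp (LaurentPolynomial ℤ) _ _ _ (mulMap (ty := ty) (n := n))) ∘ₗ mulMap =
      (LinearMap.lcomp (LaurentPolynomial ℤ) _ (mulMap (ty := ty) (n := n))) ∘ₗ
        (LinearMap.llcomp (LaurentPolynomial ℤ) _ _ _) ∘ₗ mulMap := by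
    refine hom_ext fun x => hom_ext fun y => hom_ext fun z => ?_
    change mulMap (mulMap (basis x) (basis y)) (basis z) =
      mulMap (basis x) (mulMap (basis y) (basis z))
    by_cases h : x.bot = y.top <;> by_cases h' : y.bot = z.top
    · obtain ⟨e1, e2⟩ := ODT.comp_assoc x y z h h'
      rw [mulMap_eq x y h, mulMap_eq y z h', map_smul, map_smul, LinearMap.smul_apply,
        mulMap_eq (ODT.comp x y h) z h', mulMap_eq x (ODT.comp y z h') h, smul_smul, smul_smul,
        ← LaurentPolynomial.T_add, ← LaurentPolynomial.T_add, e1, e2]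
    · rw [mulMap_eq x y h, mulMap_ne y z h', map_smul, map_zero, LinearMap.smul_apply,
        mulMap_ne (ODT.comp x y h) z h', smul_zero]
    · rw [mulMap_ne x y h, mulMap_eq y z h', map_smul, map_zero, LinearMap.zero_apply,
        mulMap_ne x (ODT.comp y z h') h, smul_zero]
    · rw [mulMap_ne x y h, mulMap_ne y z h', map_zero, map_zero, LinearMap.zero_apply]
  exact LinearMap.congr_fun (LinearMap.congr_fun (LinearMap.congr_fun this a) b) c

theorem unit_mulMap (a : OTL ty n) : mulMap (unit ty n) a = a := by
  have : mulMap (unit ty n) = LinearMap.id := by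
    refine hom_ext fun x => ?_
    rw [unit, map_sum, LinearMap.sum_apply, Finset.sum_eq_single x.top]
    · have h : (ODT.one x.top).bot = x.top := rfl
      obtain ⟨e1, e2⟩ := ODT.one_comp x.top x h
      rw [mulMap_eq _ _ h, e1, e2, LaurentPolynomial.T_zero, one_smul]; rfl
    · intro l _ hl
      exact mulMap_ne _ _ hl
    · simp
  rw [this]; rfl

theorem mulMap_unit (a : OTL ty n) : mulMap a (unit ty n) = a := by
  have : mulMap.flip (unit ty n) = LinearMap.id := by
    refine hom_ext fun x => ?_
    rw [LinearMap.flip_apply, unit, map_sum, Finset.sum_eq_single x.bot]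
    · have h : x.bot = (ODT.one x.bot).top := rfl
      obtain ⟨e1, e2⟩ := ODT.comp_one x.bot x h
      rw [mulMap_eq _ _ h, e1, e2, LaurentPolynomial.T_zero, one_smul]; rfl
    · intro l _ hl
      exact mulMap_ne _ _ (fun h => hl h.symm)
    · simp
  exact LinearMap.congr_fun this a

noncomputable instance : Ring (OTL ty n) :=
  { (inferInstance : AddCommGroup (OTL ty n)) with
    mul := fun a b => mulMap a b
    one := unit ty n
    mul_assoc := mulMap_assoc
    one_mul := unit_mulMap
    mul_one := mulMap_unit
    left_distrib := fun a b c => map_add (mulMap a) b c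
    right_distrib := fun a b c => LinearMap.map_add₂ mulMap a b c
    zero_mul := fun a => LinearMap.map_zero₂ mulMap a
    mul_zero := fun a => map_zero (mulMap a) }

noncomputable instance : Algebra (LaurentPolynomial ℤ) (OTL ty n) :=
  Algebra.ofModule (fun r a b => LinearMap.map_smul₂ mulMap r a b)
    (fun r a b => map_smul (mulMap a) r b)

/-- The product of two basis elements. -/
theorem basis_mul (x y : ODT ty n) : basis x * basis y = mulBasis x y := mulMap_basis x y

end OTL

/-- The degree of an oriented tangle: the number of northern arcs whose right end is labelled `∨` minus
the number of southern arcs whose right end is labelled `∧`. -/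
def ODT.degree (x : ODT ty n) : ℤ :=
  (Finset.univ.filter fun k =>
      (∃ j, j < k ∧ x.diag.pair (inl k) = inl j) ∧ x.top.1 k = .vee).card -
    (Finset.univ.filter fun k =>
      (∃ j, j < k ∧ x.diag.pair (inr k) = inr j) ∧ x.bot.1 k = .wedge).card

/-- The homogeneous elements of degree `i`, where `q` has degree `1`: sums of `± q^k x` over oriented
tangles `x` with `k + deg x = i`. -/
noncomputable def OTL.homogeneous (ty : PairType) (n : ℕ) (i : ℤ) : AddSubgroup (OTL ty n) :=
  AddSubgroup.closure
    {a | ∃ (k : ℤ) (x : ODT ty n), k + x.degree = i ∧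
      a = (LaurentPolynomial.T k : LaurentPolynomial ℤ) • OTL.basis x}

/-- Replace the first label by the arrow that makes the total number of `∧` even. -/
def barWord (l : Fin (n + 1) → Mark) : Fin (n + 1) → Mark :=
  Function.update l 0
    (if Even (Finset.univ.filter (fun k => l k = .wedge)).card then .vee else .wedge)

theorem barWord_isCoset (l : Coset .C n) : IsCoset .D (barWord l.1) := by
  have h0 := l.2.1
  have hb : ∀ k, k ≠ 0 → barWord l.1 k = l.1 k := fun k hk => Function.update_of_ne hk _ _
  refine ⟨fun k => ?_, ?_⟩
  · by_cases hk : k = 0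
    · subst hk; rw [barWord, Function.update_self]; split_ifs <;> simp
    · rw [barWord, Function.update_of_ne hk]; exact l.2.2 k hk
  · by_cases he : Even (Finset.univ.filter (fun k => l.1 k = .wedge)).card
    · have : (Finset.univ.filter (fun k => barWord l.1 k = .wedge)) =
          Finset.univ.filter (fun k => l.1 k = .wedge) := by
        ext k
        by_cases hk : k = 0
        · subst hk; simp [barWord, he, h0]
        · simp [hb k hk]
      rw [this]
      exact he
    · have : (Finset.univ.filter (fun k => barWord l.1 k = .wedge)) =
          insert 0 (Finset.univ.filter (fun k => l.1 k = .wedge)) := by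
        ext k
        by_cases hk : k = 0
        · subst hk; simp [barWord, he]
        · simp [hb k hk, hk]
      rw [this, Finset.card_insert_of_notMem (by simp [h0]), Nat.even_add_one]
      exact he

/-- The parity specialisation map. -/
def Coset.bar (l : Coset .C n) : Coset .D n := ⟨barWord l.1, barWord_isCoset l⟩

/-- The oriented tangle `y` arises from `x = λdμ` by passing to the parity specialisations of `λ` and `μ` and
removing the beads from all decorated strands that are oriented with respect to these. -/
structure ODT.IsSpecialisation (x : ODT .C n) (y : ODT .D n) : Prop where
  top : y.top = x.top.bar
  bot : y.bot = x.bot.bar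
  pair : y.diag.pair = x.diag.pair
  bead : ∀ v, y.diag.bead v = true ↔ x.diag.bead v = true ∧
    ¬ (boundary x.top.bar.1 x.bot.bar.1).Oriented v (x.diag.pair v)

end OrientedTL

open OrientedTL

/-!
Passing to parity specialisations turns an oriented tangle of type `C` into one of type `D` because
in type `D` the beads carry no information: every undecorated strand is oriented, every decorated
strand is flip-oriented, and no label is `∘`, so a strand is decorated exactly when it fails to be
oriented. Hence an oriented tangle of type `D` is determined by its two coset diagrams and its
underlying matching (`ODT.ext_of_pair`).

For an oriented tangle `x` of type `C`, decorate the matching of `x` by placing beads on all strands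
that are not oriented with respect to the specialised labels. Such a strand either ends in a first
vertex, and is then left exposed, or is already decorated in `x`. So the result is an oriented tangle
of type `D`. The only strand whose bead could be new is one joining the two first vertices. It shields
all other strands from the left, so a bead on it would be the only bead, against the parity of the
number of beads in type `D` (`ODT.specialise_isSpecialisation`).

Concatenation acts on matchings without regard to beads and labels, so specialisation commutes with
it by `ODT.ext_of_pair`. The powers of `q` agree too: specialisation changes only the first label of
a coset diagram, and the rightmost vertex of a closed loop is never the first vertex of a seam
(`ODT.loops_specialise`). As parity specialisation is a bijection on coset diagrams, zero products
and the unit are preserved. The right end of an arc is never a first vertex, so degrees are preserved.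
Finally, every oriented tangle of type `D` is a specialisation: restore the labels `∘` and put beads
on the strands with exactly one end labelled `∘` (`ODT.specialise_surjective`).
-/

namespace OrientedTL

open Config Sum

variable {n : ℕ}

/-! ### Beads in type `D` are determined by the orientation -/

theorem Config.Valid.bead_iff_not_oriented {α : Type} {F : Frame α} {dead : Set α} {S : Config α}
    (h : S.Valid .D F dead) {x : α} (hx : x ∉ dead) :
    S.bead x = true ↔ ¬ F.Oriented x (S.pair x) := by
  have o := h.oriented x hx
  have f := h.flip rfl x
  have n1 := h.noCirc rfl x
  have n2 := h.noCirc rfl (S.pair x)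
  simp only [Frame.Oriented, Frame.FlipOriented, n1, n2, false_or] at o f ⊢
  cases hb : S.bead x <;> grind

theorem ODT.ext_of_pair {x y : ODT .D n} (ht : x.top = y.top) (hb : x.bot = y.bot)
    (hp : x.diag.pair = y.diag.pair) : x = y := by
  refine ODT.ext ht hb (Config.ext hp (funext fun v => ?_))
  rw [Bool.eq_iff_iff, x.valid.bead_iff_not_oriented (by simp),
    y.valid.bead_iff_not_oriented (by simp), ht, hb, hp]

/-! ### Parity specialisation of coset diagrams -/

theorem Coset.bar_apply (l : Coset .C n) {k : Fin (n + 1)} (hk : k ≠ 0) : l.bar.1 k = l.1 k :=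
  Function.update_of_ne hk _ _

theorem Coset.bar_injective : Function.Injective (Coset.bar (n := n)) := by
  intro l m h
  refine Subtype.ext (funext fun k => ?_)
  by_cases hk : k = 0
  · rw [hk, l.2.1, m.2.1]
  · rw [← l.bar_apply hk, ← m.bar_apply hk, h]

/-- Two coset diagrams of type `D` that agree away from the first vertex are equal, since the parity
determines the first label. -/
theorem Coset.ext_of_ne_zero {l m : Coset .D n} (h : ∀ k, k ≠ 0 → l.1 k = m.1 k) : l = m := by
  have tail : ∀ p : Coset .D n, p.1 0 = .wedge ↔
      ¬ Even (Finset.univ.filter fun k => k ≠ 0 ∧ p.1 k = .wedge).card := by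
    intro p
    have hp := p.2.2
    by_cases h0 : p.1 0 = .wedge
    · have e : (Finset.univ.filter fun k => p.1 k = .wedge) =
          insert 0 (Finset.univ.filter fun k => k ≠ 0 ∧ p.1 k = .wedge) := by
        ext k; by_cases hk : k = 0 <;> simp [hk, h0]
      rw [e, Finset.card_insert_of_notMem (by simp), Nat.even_add_one] at hp
      exact iff_of_true h0 hp
    · have e : (Finset.univ.filter fun k => p.1 k = .wedge) =
          (Finset.univ.filter fun k => k ≠ 0 ∧ p.1 k = .wedge) := by
        ext k; by_cases hk : k = 0 <;> simp [hk, h0]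
      rw [e] at hp
      exact iff_of_false h0 (not_not.2 hp)
  have h0 : l.1 0 = .wedge ↔ m.1 0 = .wedge := by
    rw [tail l, tail m]
    have e : (Finset.univ.filter fun k => k ≠ 0 ∧ l.1 k = .wedge) =
        (Finset.univ.filter fun k => k ≠ 0 ∧ m.1 k = .wedge) :=
      Finset.filter_congr fun k _ => and_congr_right fun hk => by rw [h k hk]
    rw [e]
  refine Subtype.ext (funext fun k => ?_)
  by_cases hk : k = 0
  · subst hk
    have c1 := l.2.1 0
    have c2 := m.2.1 0
    cases e1 : l.1 0 <;> cases e2 : m.1 0 <;> simp_all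
  · exact h k hk

/-- The coset diagram of type `C` obtained by replacing the first label by `∘`. -/
def Coset.unbar (m : Coset .D n) : Coset .C n :=
  ⟨Function.update m.1 0 .circ, Function.update_self _ _ _,
    fun k hk => by rw [Function.update_of_ne hk]; exact m.2.1 k⟩

theorem Coset.bar_unbar (m : Coset .D n) : m.unbar.bar = m :=
  Coset.ext_of_ne_zero fun _ hk => (m.unbar.bar_apply hk).trans (Function.update_of_ne hk _ _)

theorem Coset.bar_bijective : Function.Bijective (Coset.bar (n := n)) :=
  ⟨Coset.bar_injective, fun m => ⟨m.unbar, m.bar_unbar⟩⟩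

/-- Away from the vertices labelled `∘`, specialisation changes neither labels nor orientations. -/
theorem oriented_bar {l m : Coset .C n} {v w : Vertex n}
    (hv : (boundary l.1 m.1).mark v ≠ .circ) (hw : (boundary l.1 m.1).mark w ≠ .circ) :
    (boundary l.bar.1 m.bar.1).Oriented v w ↔ (boundary l.1 m.1).Oriented v w := by
  have e : ∀ u, (boundary l.1 m.1).mark u ≠ .circ →
      (boundary l.bar.1 m.bar.1).mark u = (boundary l.1 m.1).mark u := by
    intro u hu
    rw [Ne, boundary_circ, not_or] at hu
    rcases u with k | k
    · exact l.bar_apply fun h => hu.1 (by rw [h])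
    · exact m.bar_apply fun h => hu.2 (by rw [h])
  have s : (boundary l.bar.1 m.bar.1).south = (boundary l.1 m.1).south := rfl
  simp only [Frame.Oriented, Frame.Inward, e v hv, e w hw, s]

/-! ### Specialisation of oriented tangles -/

theorem vertexPos_inl_zero : vertexPos (inl 0 : Vertex n) = 0 := rfl

theorem vertexPos_inr_zero : vertexPos (inr 0 : Vertex n) = 2 * n + 1 := rfl

/-- A strand ending in the first northern or the first southern vertex is left exposed. -/
theorem exposed_of_first {d : Config (Vertex n)} {v : Vertex n}
    (h : (v = inl 0 ∨ v = inr 0) ∨ (d.pair v = inl 0 ∨ d.pair v = inr 0)) :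
    d.Exposed vertexPos v := by
  rintro y ⟨h1, h2, h3, h4⟩
  have hy := vertexPos_lt (d.pair y)
  rcases h with (h | h) | (h | h) <;> simp only [h, vertexPos_inl_zero, vertexPos_inr_zero] at * <;>
    omega

open Classical in
/-- The matching `p` with beads on all strands that are not oriented. -/
noncomputable def orientationBeads {α : Type} (F : Frame α) (p : α → α) : Config α where
  pair := p
  bead v := decide (¬ F.Oriented v (p v))

namespace ODT

/-- In type `C`, an undecorated strand that has an end labelled `∘` joins the two first vertices. -/
theorem pair_first_of_bead_false (x : ODT .C n) {v : Vertex n} (hb : x.diag.bead v = false)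
    (h : x.frame.mark v = .circ ∨ x.frame.mark (x.diag.pair v) = .circ) :
    x.diag.pair (inl 0) = inr 0 := by
  have inv := x.valid.inv
  have c : x.frame.mark v = .circ ∧ x.frame.mark (x.diag.pair v) = .circ := by
    rcases h with h | h
    · have := x.valid.circ rfl v (by simp) h
      rw [hb] at this
      exact ⟨h, by simpa [ODT.frame] using this⟩
    · have := x.valid.circ rfl (x.diag.pair v) (by simp) h
      rw [inv, x.valid.bead_pair, hb] at this
      exact ⟨by simpa [ODT.frame] using this, h⟩
  have ne := x.isTangle.pair_ne v
  rw [frame, boundary_circ, boundary_circ] at c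
  have iv := inv v
  rcases c with ⟨rfl | rfl, e | e⟩
  · exact absurd e ne
  · exact e
  · rwa [e] at iv
  · exact absurd e ne

/-- The frame of `x` with specialised labels. -/
def barFrame (x : ODT .C n) : Frame (Vertex n) := boundary x.top.bar.1 x.bot.bar.1

theorem orientationBeads_valid (x : ODT .C n) :
    (orientationBeads x.barFrame x.diag.pair).Valid .D x.barFrame ∅ where
  inv := x.valid.inv
  dead_iff := x.valid.dead_iff
  nc := x.valid.nc
  bead_pair v := by
    simp only [orientationBeads, x.valid.inv, decide_eq_decide]
    exact not_congr ⟨Frame.Oriented.symm, Frame.Oriented.symm⟩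
  bead_dead v hv := by simp at hv
  exposed v hv := by
    simp only [orientationBeads, decide_eq_true_eq] at hv
    by_cases h : (v = inl 0 ∨ v = inr 0) ∨ (x.diag.pair v = inl 0 ∨ x.diag.pair v = inr 0)
    · exact exposed_of_first h
    · rw [← boundary_circ (l := x.top) (m := x.bot), ← boundary_circ (l := x.top) (m := x.bot),
        not_or] at h
      rw [barFrame, oriented_bar h.1 h.2] at hv
      exact x.isTangle.exposed v (by by_contra hb; exact hv (x.oriented v (by simpa using hb)))
  oriented v _ hv := by simpa [orientationBeads] using hv
  flip _ v hv := by
    simp only [orientationBeads, decide_eq_true_eq] at hv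
    simp only [Frame.Oriented, Frame.FlipOriented, orientationBeads] at hv ⊢
    grind
  noCirc _ := boundary_noCirc
  circ h := by cases h

/-- The parity specialisation of an oriented tangle of type `C`. -/
noncomputable def specialise (x : ODT .C n) : ODT .D n :=
  ofValid x.top.bar x.bot.bar _ x.orientationBeads_valid

theorem specialise_bead {x : ODT .C n} {v : Vertex n} :
    x.specialise.diag.bead v = true ↔ ¬ x.barFrame.Oriented v (x.diag.pair v) := by
  simp [specialise, ofValid, orientationBeads]

/-- An undecorated strand joining the two first vertices is oriented with respect to the specialised
labels: otherwise its bead would be the only one in the specialisation. -/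
theorem oriented_first (x : ODT .C n) (h : x.diag.pair (inl 0) = inr 0) :
    x.barFrame.Oriented (inl 0) (inr 0) := by
  by_contra ho
  have even := x.specialise.inDT
  have hp : x.specialise.diag.pair (inl 0) = inr 0 := h
  have hb : x.specialise.diag.bead (inl 0) = true := specialise_bead.2 (by rwa [h])
  have e : (Finset.univ.filter fun v => x.specialise.diag.bead v = true ∧
      vertexPos v < vertexPos (x.specialise.diag.pair v)) = {inl 0} := by
    ext v
    simp only [Finset.mem_filter, Finset.mem_univ, true_and, Finset.mem_singleton]
    constructor
    · rintro ⟨h1, h2⟩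
      by_contra hv
      have ex := x.specialise.isTangle.exposed v h1 (inl 0)
      rw [hp] at ex
      have p0 : vertexPos v ≠ vertexPos (inl 0 : Vertex n) := fun e => hv (vertexPos_injective e)
      have p1 : vertexPos (x.specialise.diag.pair v) ≠ vertexPos (inr 0 : Vertex n) := by
        intro e
        have := congrArg x.specialise.diag.pair (vertexPos_injective e)
        rw [x.specialise.isTangle.pair_pair, ← hp, x.specialise.isTangle.pair_pair] at this
        exact hv this
      have q := vertexPos_lt (x.specialise.diag.pair v)
      rw [vertexPos_inl_zero] at ex p0
      rw [vertexPos_inr_zero] at ex p1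
      omega
    · rintro rfl
      refine ⟨hb, ?_⟩
      rw [hp]
      simp [vertexPos]
  simp only [InDT] at even
  rw [e] at even
  simp at even

theorem specialise_isSpecialisation (x : ODT .C n) : x.IsSpecialisation x.specialise where
  top := rfl
  bot := rfl
  pair := rfl
  bead v := by
    rw [specialise_bead]
    refine ⟨fun h => ⟨?_, h⟩, And.right⟩
    by_contra hb
    rw [Bool.not_eq_true] at hb
    have inv := x.valid.inv
    by_cases hc : x.frame.mark v = .circ ∨ x.frame.mark (x.diag.pair v) = .circ
    · have h0 := x.pair_first_of_bead_false hb hc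
      have h1 : x.diag.pair (inr 0) = inl 0 := by rw [← h0, inv]
      have o := x.oriented_first h0
      have hv : v = inl 0 ∨ v = inr 0 := by
        rw [frame, boundary_circ, boundary_circ] at hc
        rcases hc with hc | hc | hc
        · exact hc
        · right; rw [← h0, ← hc, inv]
        · left; rw [← h1, ← hc, inv]
      rcases hv with rfl | rfl
      · exact h (by rwa [h0])
      · exact h (by rw [h1]; exact o.symm)
    · rw [not_or] at hc
      exact h ((oriented_bar hc.1 hc.2).2 (x.oriented v hb))

/-- Every oriented tangle of type `D` is a parity specialisation. -/
theorem specialise_surjective : Function.Surjective (specialise (n := n)) := by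
  classical
  intro y
  let F := boundary y.top.unbar.1 y.bot.unbar.1
  -- In type `C` a strand with exactly one end labelled `∘` carries a bead, one with two does not.
  let d : Config (Vertex n) :=
    { pair := y.diag.pair
      bead := fun v =>
        if F.mark v = .circ then decide (F.mark (y.diag.pair v) ≠ .circ)
        else if F.mark (y.diag.pair v) = .circ then true else y.diag.bead v }
  have hd : d.Valid .C F ∅ :=
    { inv := y.valid.inv
      dead_iff := y.valid.dead_iff
      nc := y.valid.nc
      bead_pair := fun v => by
        simp only [d, y.valid.inv, y.valid.bead_pair]
        split_ifs <;> simp_all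
      bead_dead := fun v hv => by simp at hv
      exposed := fun v hv => by
        by_cases h : (v = inl 0 ∨ v = inr 0) ∨ (d.pair v = inl 0 ∨ d.pair v = inr 0)
        · exact exposed_of_first h
        · rw [← boundary_circ (l := y.top.unbar) (m := y.bot.unbar),
            ← boundary_circ (l := y.top.unbar) (m := y.bot.unbar), not_or] at h
          simp only [d, F, if_neg h.1] at hv
          rw [if_neg h.2] at hv
          exact y.isTangle.exposed v hv
      oriented := fun v _ hv => by
        by_cases h1 : F.mark v = .circ
        · exact .inl h1
        by_cases h2 : F.mark (y.diag.pair v) = .circ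
        · exact .inr (.inl h2)
        simp only [d, if_neg h1, if_neg h2] at hv
        have o := y.oriented v hv
        rw [← y.top.bar_unbar, ← y.bot.bar_unbar] at o
        exact (oriented_bar h1 h2).1 o
      flip := fun h => by cases h
      noCirc := fun h => by cases h
      circ := fun _ v _ hv => by simp [d, hv] }
  exact ⟨ofValid y.top.unbar y.bot.unbar d hd,
    ext_of_pair y.top.bar_unbar y.bot.bar_unbar rfl⟩

theorem specialise_one (l : Coset .C n) : (one l).specialise = one l.bar :=
  ext_of_pair rfl rfl rfl

/-- The right end of an arc is not a first vertex, so its label is not changed. -/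
theorem degree_specialise (x : ODT .C n) : x.specialise.degree = x.degree := by
  have h : ∀ (l : Coset .C n) (P : Fin (n + 1) → Fin (n + 1) → Prop) (a : Mark) (k : Fin (n + 1)),
      ((∃ j, j < k ∧ P j k) ∧ l.bar.1 k = a) ↔ ((∃ j, j < k ∧ P j k) ∧ l.1 k = a) := by
    refine fun l P a _ => and_congr_right ?_
    rintro ⟨j, hj, -⟩
    rw [l.bar_apply (Fin.ne_zero_of_lt hj)]
  have e1 := h x.top fun j k => x.diag.pair (inl k) = inl j
  have e2 := h x.bot fun j k => x.diag.pair (inr k) = inr j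
  change ((Finset.univ.filter fun k => (∃ j, j < k ∧ x.diag.pair (inl k) = inl j) ∧
    x.top.bar.1 k = .vee).card : ℤ) - (Finset.univ.filter fun k =>
      (∃ j, j < k ∧ x.diag.pair (inr k) = inr j) ∧ x.bot.bar.1 k = .wedge).card = _
  simp only [degree, e1, e2]

end ODT

/-! ### Concatenation -/

section Gluing

variable {α : Type} [DecidableEq α] {ty ty' : PairType} {F F' : Frame α}

theorem Config.join_pair_congr {S S' : Config α} (h : S.pair = S'.pair) (i j : α) :
    (S.join ty F i j).pair = (S'.join ty' F' i j).pair := by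
  simp only [Config.join, h]

theorem Config.joinAll_pair_congr (l : List (α × α)) : ∀ {S S' : Config α}, S.pair = S'.pair →
    (S.joinAll ty F l).pair = (S'.joinAll ty' F' l).pair := by
  induction l with
  | nil => exact fun h => h
  | cons p l ih => exact fun h => ih (join_pair_congr h p.1 p.2)

theorem Config.loopTotal_congr (l : List (α × α)) (hm : ∀ p ∈ l, F.mark p.1 = F'.mark p.1) :
    ∀ {S S' : Config α}, S.pair = S'.pair → S.loopTotal ty F l = S'.loopTotal ty' F' l := by
  induction l with
  | nil => exact fun _ => rfl
  | cons p l ih =>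
    intro S S' h
    simp only [loopTotal, loopDegree, h, hm p (by simp)]
    rw [ih (fun q hq => hm q (by simp [hq])) (join_pair_congr h p.1 p.2)]

end Gluing

namespace ODT

theorem stack_pair_specialise (x y : ODT .C n) :
    (stack ![x.specialise.diag, y.specialise.diag]).pair = (stack ![x.diag, y.diag]).pair := by
  funext ⟨i, v⟩
  fin_cases i <;> rfl

/-- No loop is closed when the first vertices of the seam are glued, because they still lie on
different tangles; the labels of the other vertices are not changed by specialisation. -/
theorem loops_specialise (x y : ODT .C n) : loops x.specialise y.specialise = loops x y := by
  have hs : seam n (0 : Fin 2) 1 = ((0, inr 0), (1, inl 0)) ::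
      (List.finRange n).map fun k => ((0, inr k.succ), (1, inl k.succ)) := by
    simp [seam, List.finRange_succ, Function.comp_def]
  have hp := stack_pair_specialise x y
  simp only [loops, hs, loopTotal]
  refine congrArg₂ (· + ·) ?_ ?_
  · simp [loopDegree, stack]
  · refine loopTotal_congr _ ?_ (join_pair_congr hp _ _)
    intro p hp
    obtain ⟨k, -, rfl⟩ := List.mem_map.1 hp
    exact x.bot.bar_apply (Fin.succ_ne_zero k)

theorem specialise_comp (x y : ODT .C n) (h : x.bot = y.top)
    (h' : x.specialise.bot = y.specialise.top) :
    (comp x y h).specialise = comp x.specialise y.specialise h' := by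
  refine ext_of_pair rfl rfl (funext fun v => ?_)
  change ((glued x y).pair (outer v)).2 = ((glued x.specialise y.specialise).pair (outer v)).2
  rw [glued, glued, joinAll_pair_congr _ (stack_pair_specialise x y)]

end ODT

/-! ### The homomorphism of algebras -/

namespace OTL

/-- The linear extension of the specialisation of oriented tangles. -/
noncomputable def specialiseLinear (n : ℕ) : OTL .C n →ₗ[LaurentPolynomial ℤ] OTL .D n :=
  lift fun x => basis x.specialise

theorem specialiseLinear_basis (x : ODT .C n) :
    specialiseLinear n (basis x) = basis x.specialise :=
  lift_basis _ x

theorem specialiseLinear_one : specialiseLinear n 1 = 1 := by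
  change specialiseLinear n (unit .C n) = unit .D n
  simp only [unit, map_sum, specialiseLinear_basis, ODT.specialise_one]
  exact Coset.bar_bijective.sum_comp fun l => basis (ODT.one l)

theorem specialiseLinear_mul (a b : OTL .C n) :
    specialiseLinear n (a * b) = specialiseLinear n a * specialiseLinear n b := by
  have : (LinearMap.llcomp (LaurentPolynomial ℤ) _ _ _ (specialiseLinear n)) ∘ₗ
      mulMap (ty := .C) (n := n) =
      (LinearMap.lcomp (LaurentPolynomial ℤ) _ (specialiseLinear n)) ∘ₗ
        mulMap (ty := .D) (n := n) ∘ₗ specialiseLinear n := by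
    refine hom_ext fun x => hom_ext fun y => ?_
    change specialiseLinear n (mulMap (basis x) (basis y)) =
      mulMap (specialiseLinear n (basis x)) (specialiseLinear n (basis y))
    rw [specialiseLinear_basis, specialiseLinear_basis]
    by_cases h : x.bot = y.top
    · have h' : x.specialise.bot = y.specialise.top := congrArg Coset.bar h
      rw [mulMap_eq x y h, mulMap_eq _ _ h', map_smul, specialiseLinear_basis,
        ODT.specialise_comp x y h h', ODT.loops_specialise]
    · rw [mulMap_ne x y h, mulMap_ne x.specialise y.specialise fun e => h (Coset.bar_injective e),
        map_zero]
  exact LinearMap.congr_fun (LinearMap.congr_fun this a) b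

/-- The homomorphism of algebras that sends an oriented tangle to its parity specialisation. -/
noncomputable def specialiseHom (n : ℕ) : OTL .C n →ₐ[LaurentPolynomial ℤ] OTL .D n :=
  AlgHom.ofLinearMap (specialiseLinear n) specialiseLinear_one specialiseLinear_mul

theorem specialiseHom_basis (x : ODT .C n) : specialiseHom n (basis x) = basis x.specialise :=
  specialiseLinear_basis x

theorem specialiseHom_surjective : Function.Surjective (specialiseHom n) := by
  -- A linear section: send each basis element to a chosen preimage.
  have section_id : specialiseLinear n ∘ₗ
      lift (fun y => basis (Function.surjInv ODT.specialise_surjective y)) = LinearMap.id := by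
    refine hom_ext fun y => ?_
    rw [LinearMap.comp_apply, lift_basis, specialiseLinear_basis,
      Function.surjInv_eq ODT.specialise_surjective, LinearMap.id_apply]
  exact fun b => ⟨_, LinearMap.congr_fun section_id b⟩

theorem specialiseHom_homogeneous {i : ℤ} {a : OTL .C n} (ha : a ∈ homogeneous .C n i) :
    specialiseHom n a ∈ homogeneous .D n i := by
  have le : homogeneous .C n i ≤
      (homogeneous .D n i).comap (specialiseHom n : OTL .C n →+ OTL .D n) := by
    refine (AddSubgroup.closure_le _).2 ?_
    rintro _ ⟨k, x, hk, rfl⟩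
    refine AddSubgroup.subset_closure ⟨k, x.specialise, by rw [x.degree_specialise, hk], ?_⟩
    exact (map_smul (specialiseLinear n) _ _).trans (congrArg _ (specialiseLinear_basis x))
  exact le ha

end OTL

end OrientedTL

theorem mainTheorem9 (n : ℕ) (hn : 2 ≤ n) :
    ∃ φ : OTL .C n →ₐ[LaurentPolynomial ℤ] OTL .D n,
      (∀ x : ODT .C n, ∃ y : ODT .D n, x.IsSpecialisation y ∧ φ (OTL.basis x) = OTL.basis y) ∧
      Function.Surjective φ ∧
      ∀ i : ℤ, ∀ a ∈ OTL.homogeneous .C n i, φ a ∈ OTL.homogeneous .D n i :=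
  ⟨OTL.specialiseHom n,
    fun x => ⟨x.specialise, x.specialise_isSpecialisation, OTL.specialiseHom_basis x⟩,
    OTL.specialiseHom_surjective, fun _ _ ha => OTL.specialiseHom_homogeneous ha⟩
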